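/- Conventions. All subgroups of profinite groups are closed. A profinite group $G$ is *just infinite* if it is infinite and every nontrivial normal subgroup of $G$ has finite index; it is *hereditarily just infinite* if in addition every open subgroup of $G$ is just infinite. A *chief factor* of $G$ is a quotient $K/L$ with $L < K$ normal subgroups of $G$ such that no normal subgroup $M$ of $G$ satisfies $L < M < K$. For a nontrivial normal subgroup $A$ of a finite group $G$, $\mathrm{M}_G(A)$ denotes the intersection of all maximal $G$-invariant subgroups of $A$, that is, of all maximal elements of the set of normal subgroups of $G$ properly contained in $A$. A normal subgroup $U$ of a finite group $G$ is *basally centrally indecomposable in $G$* if there is no conjugacy class of subgroups of $G$, consisting of proper subgroups of $U$, whose members generate $U$ and such that any two distinct members centralize each other. Classes of finite groups are closed under isomorphism. Theorem 5.1. (a) Let $G$ be a hereditarily just infinite profinite group. Let $\mathcal{C}_1,\mathcal{C}_2,\dots$ be a sequence of classes of finite groups such that, for every $n$, $G$ has infinitely many chief factors in $\mathcal{C}_n$. Then $G$ is isomorphic (as a topological group) to the limit of an inverse system $\Lambda=\{(G_n)_{n>0},\ \rho_n : G_{n+1}\twoheadrightarrow G_n\}$ of finite groups and surjective homomorphisms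 in which each $G_n$ has a specified nontrivial normal subgroup $A_n$ such that, setting $P_n=\rho_n(A_{n+1})$, the following hold for all $n>0$: (i) $\mathrm{M}_{G_{n+1}}(A_{n+1}) \ge \ker\rho_n \ge P_{n+1}$; (ii) each normal subgroup of $G_n$ contains $P_n$ or is contained in $A_n$ (or both); (iii) $P_n$ is a minimal normal subgroup of $G_n$; (iv) $P_n\in\mathcal{C}_n$; (v) in $G_n$, every normal subgroup containing $A_n$ is basally centrally indecomposable. (b) Conversely, let $\{(G_n)_{n>0},\ \rho_n : G_{n+1}\twoheadrightarrow G_n\}$ be an inverse system of finite groups and surjective homomorphisms, with specified nontrivial normal subgroups $A_n$ of $G_n$, and set $P_n=\rho_n(A_{n+1})$. If conditions (i) and (ii) hold for all but finitely many $n$ and condition (v) holds for infinitely many $n$, then the limit of the system is a hereditarily just infinite profinite group. -/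

import Mathlib

open scoped Pointwise

universe u

/-! ## Just infinite groups and chief factors -/

/-- A (profinite) group is just infinite if it is infinite and every nontrivial closed normal
subgroup has finite index. -/
def IsJustInfinite (G : Type u) [Group G] [TopologicalSpace G] : Prop :=
  Infinite G ∧
    ∀ N : Subgroup G, N.Normal → IsClosed (N : Set G) → N ≠ ⊥ → N.FiniteIndex

/-- A profinite group is hereditarily just infinite if it is just infinite and all of its open
subgroups are just infinite. The last three instance arguments say that `G` is profinite. -/
def IsHereditarilyJustInfinite (G : Type u) [Group G] [TopologicalSpace G]
    [IsTopologicalGroup G] [CompactSpace G] [TotallyDisconnectedSpace G] : Prop :=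
  IsJustInfinite G ∧ ∀ H : Subgroup G, IsOpen (H : Set G) → IsJustInfinite H

/-- A chief factor `top / bot` of a topological group: `bot < top` are closed normal subgroups and
no closed normal subgroup lies strictly between them. -/
structure ChiefFactor (G : Type u) [Group G] [TopologicalSpace G] where
  top : Subgroup G
  bot : Subgroup G
  top_normal : top.Normal
  bot_normal : bot.Normal
  top_closed : IsClosed (top : Set G)
  bot_closed : IsClosed (bot : Set G)
  bot_lt_top : bot < top
  chief : ∀ M : Subgroup G, M.Normal → IsClosed (M : Set G) → ¬ (bot < M ∧ M < top)

namespace ChiefFactor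

variable {G : Type u} [Group G] [TopologicalSpace G]

instance normal_subgroupOf (c : ChiefFactor G) : (c.bot.subgroupOf c.top).Normal :=
  haveI := c.bot_normal
  inferInstance

/-- The quotient group of a chief factor. -/
abbrev Quotient (c : ChiefFactor G) : Type u := c.top ⧸ c.bot.subgroupOf c.top

end ChiefFactor

/-- A class of finite groups (closed under isomorphism, as usual). -/
structure FiniteGroupClass where
  Mem : (H : Type u) → [Group H] → Prop
  finite_of_mem : ∀ (H : Type u) [Group H], Mem H → Finite H
  mem_of_mulEquiv : ∀ (H H' : Type u) [Group H] [Group H'], (H ≃* H') → Mem H → Mem H'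

/-! ## Inverse systems of finite groups and their limits -/

/-- An inverse system of finite groups indexed by `ℕ`, with surjective maps. -/
structure FiniteInverseSystem where
  obj : ℕ → Type u
  group : ∀ n, Group (obj n)
  finite : ∀ n, Finite (obj n)
  ρ : ∀ n, obj (n + 1) →* obj n
  surjective : ∀ n, Function.Surjective (ρ n)

namespace FiniteInverseSystem

attribute [instance] FiniteInverseSystem.group FiniteInverseSystem.finite

variable (Λ : FiniteInverseSystem.{u})

instance topology (n : ℕ) : TopologicalSpace (Λ.obj n) := ⊥

instance discrete (n : ℕ) : DiscreteTopology (Λ.obj n) := ⟨rfl⟩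

/-- The inverse limit, as the subgroup of compatible sequences of the product, with the topology
induced by the product of the discrete topologies. -/
def limit : Subgroup (∀ n, Λ.obj n) where
  carrier := {x | ∀ n, Λ.ρ n (x (n + 1)) = x n}
  mul_mem' := by
    intro a b ha hb n
    simp only [Set.mem_ofPred_eq] at ha hb
    simp [ha n, hb n]
  one_mem' := by
    intro n
    simp
  inv_mem' := by
    intro a ha n
    simp only [Set.mem_ofPred_eq] at ha
    simp [ha n]

/-- The underlying topological group of the inverse limit. -/
abbrev Limit : Type u := Λ.limit

theorem isClosed_limit : IsClosed (Λ.limit : Set (∀ n, Λ.obj n)) := by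
  have h : (Λ.limit : Set (∀ n, Λ.obj n)) = ⋂ n, {x | Λ.ρ n (x (n + 1)) = x n} := by
    ext x
    simp [limit]
  rw [h]
  refine isClosed_iInter fun n => isClosed_eq ?_ ?_
  · exact (continuous_of_discreteTopology (f := Λ.ρ n)).comp (continuous_apply (n + 1))
  · exact continuous_apply n

instance compactSpace_limit : CompactSpace Λ.Limit :=
  isCompact_iff_compactSpace.mp Λ.isClosed_limit.isCompact

/-- The subgroup `P n = ρ n (A (n + 1))` of the `n`-th group. -/
def P (A : ∀ n, Subgroup (Λ.obj n)) (n : ℕ) : Subgroup (Λ.obj n) :=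
  (A (n + 1)).map (Λ.ρ n)

end FiniteInverseSystem

/-! ## Notions for finite groups -/

section FiniteGroups

variable {G : Type u} [Group G]

/-- `B` is a maximal `G`-invariant subgroup of `A`: it is a proper `G`-invariant subgroup of `A`,
maximal among these. (`G`-invariant subgroups of `A` are normal subgroups of `G` inside `A`.) -/
def IsMaximalInvariant (A B : Subgroup G) : Prop :=
  Maximal (fun C : Subgroup G => C.Normal ∧ C < A) B

/-- `M_G(A)`, the intersection of all maximal `G`-invariant subgroups of `A` (used for a nontrivial
normal subgroup `A` of a finite group `G`). -/
def invariantCosocle (A : Subgroup G) : Subgroup G :=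
  A ⊓ sInf {B : Subgroup G | IsMaximalInvariant A B}

/-- `N` is a minimal normal subgroup of `G`. -/
def IsMinimalNormal (N : Subgroup G) : Prop :=
  Minimal (fun C : Subgroup G => C.Normal ∧ C ≠ ⊥) N

/-- `U` is the central product of the subgroups in `𝓗`: they generate `U`, and distinct ones
commute. -/
def IsCentralProduct (U : Subgroup G) (𝓗 : Set (Subgroup G)) : Prop :=
  sSup 𝓗 = U ∧ ∀ X ∈ 𝓗, ∀ Y ∈ 𝓗, X ≠ Y → ⁅X, Y⁆ = ⊥

/-- The normal subgroup `U` of `G` is a basal central product of the subgroups in `𝓗`: a central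
product such that `𝓗` is a conjugacy class of subgroups of `G`. -/
def IsBasalCentralProduct (U : Subgroup G) (𝓗 : Set (Subgroup G)) : Prop :=
  U.Normal ∧ IsCentralProduct U 𝓗 ∧
    ∃ V : Subgroup G, 𝓗 = Set.range fun g : G => MulAut.conj g • V

/-- `U` is basally centrally indecomposable in `G`: it is not a basal central product in `G` of
proper subgroups of `U`. -/
def IsBasallyCentrallyIndecomposable (U : Subgroup G) : Prop :=
  ¬ ∃ 𝓗 : Set (Subgroup G), IsBasalCentralProduct U 𝓗 ∧ ∀ X ∈ 𝓗, X < U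

end FiniteGroups

/-! ## The conditions on an inverse system with specified subgroups -/

namespace FiniteInverseSystem

variable (Λ : FiniteInverseSystem.{u}) (A : ∀ n, Subgroup (Λ.obj n))

/-- `M_{G (n + 1)} (A (n + 1)) ≥ ker (ρ n) ≥ P (n + 1)`. -/
def CondI (n : ℕ) : Prop :=
  Λ.P A (n + 1) ≤ (Λ.ρ n).ker ∧ (Λ.ρ n).ker ≤ invariantCosocle (A (n + 1))

/-- Each normal subgroup of `G n` contains `P n` or is contained in `A n`. -/
def CondII (n : ℕ) : Prop :=
  ∀ N : Subgroup (Λ.obj n), N.Normal → Λ.P A n ≤ N ∨ N ≤ A n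

/-- `P n` is a minimal normal subgroup of `G n`. -/
def CondIII (n : ℕ) : Prop :=
  IsMinimalNormal (Λ.P A n)

/-- `P n` belongs to the class `𝒞`. -/
def CondIV (𝒞 : FiniteGroupClass.{u}) (n : ℕ) : Prop :=
  𝒞.Mem (Λ.P A n)

/-- Every normal subgroup of `G n` containing `A n` is basally centrally indecomposable. -/
def CondV (n : ℕ) : Prop :=
  ∀ U : Subgroup (Λ.obj n), U.Normal → A n ≤ U → IsBasallyCentrallyIndecomposable U

end FiniteInverseSystem

set_option linter.unusedSectionVars false

/-! ### Open normal subgroups of profinite groups. -/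

section Basics

variable {G : Type u} [Group G] [TopologicalSpace G] [IsTopologicalGroup G] [CompactSpace G]
  [TotallyDisconnectedSpace G]

/-! Both halves translate the inverse system into a chain of subgroups of `G`: `K n` is the kernel
of `G → G_n`, `B n` is the preimage of `A n`, and the chain interlaces as `B (n + 2) ≤ K n < B (n +
1)`.

For (a), the main tool is generalised obliquity (`finite_not_le`): an open subgroup of a just
infinite group contains all but finitely many closed normal subgroups, hence the tops of all but
finitely many chief factors. A chief factor `R/S` in the prescribed class can therefore be found
arbitrarily deep. Take `B (n + 1)` minimal among the closed normal subgroups of `R` not inside `S`,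
and `K n = B (n + 1) ⊓ S`. Then `B (n + 1)/K n ≅ R/S`, and every closed normal subgroup properly
inside `B (n + 1)` lies in `K n`; this gives (i), (iii) and (iv), while depth gives (ii). For (v),
obliquity in an open normal `U` leaves finitely many subgroups `V` that could generate `U` basally
modulo a small `K`. None does so with `K` trivial (`not_conj_generate`), so a small enough `K`
excludes them all.

For (b), (i) and (ii) force a nontrivial closed normal `N` to satisfy `N K_j = N K_(j+1)` for all
large `j`, so `N` contains some `K_j`. If a just infinite group fails to be hereditarily so, a
nontrivial intersection of conjugates of a bad subgroup generates an open normal subgroup as a basal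
central product (`IsJustInfinite.isHereditarilyJustInfinite`); its image in a deep `G_n` contradicts
(v). -/

theorem exists_isOpen_normal_le_of_mem_nhds {s : Set G} (hs : IsOpen s) (h1 : (1 : G) ∈ s) :
    ∃ W : Subgroup G, W.Normal ∧ IsOpen (W : Set G) ∧ (W : Set G) ⊆ s := by
  obtain ⟨W, hW⟩ := ProfiniteGrp.exist_openNormalSubgroup_sub_open_nhds_of_one hs h1
  exact ⟨W.toSubgroup, W.isNormal', W.isOpen', hW⟩

theorem exists_isOpen_normal_le {H : Subgroup G} (hH : IsOpen (H : Set G)) :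
    ∃ W : Subgroup G, W.Normal ∧ IsOpen (W : Set G) ∧ W ≤ H :=
  exists_isOpen_normal_le_of_mem_nhds hH H.one_mem

theorem exists_isOpen_normal_notMem {x : G} (hx : x ≠ 1) :
    ∃ W : Subgroup G, W.Normal ∧ IsOpen (W : Set G) ∧ x ∉ W := by
  obtain ⟨W, hn, ho, hW⟩ := exists_isOpen_normal_le_of_mem_nhds
    (isOpen_compl_singleton (x := x)) (by simpa using hx.symm)
  exact ⟨W, hn, ho, fun h => hW h rfl⟩

theorem exists_isOpen_normal_not_le {N : Subgroup G} (hN : N ≠ ⊥) :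
    ∃ W : Subgroup G, W.Normal ∧ IsOpen (W : Set G) ∧ ¬ N ≤ W := by
  obtain ⟨x, hx, hx1⟩ := N.bot_or_exists_ne_one.resolve_left hN
  obtain ⟨W, hn, ho, hW⟩ := exists_isOpen_normal_notMem hx1
  exact ⟨W, hn, ho, fun h => hW (h hx)⟩

theorem finiteIndex_of_isOpen {H : Subgroup G} (hH : IsOpen (H : Set G)) : H.FiniteIndex := by
  have := H.quotient_finite_of_isOpen hH
  exact Subgroup.finiteIndex_of_finite_quotient

end Basics

theorem Subgroup.ne_bot_of_finiteIndex {G : Type u} [Group G] [Infinite G] (N : Subgroup G)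
    [hN : N.FiniteIndex] : N ≠ ⊥ := by
  rintro rfl
  have := hN.index_ne_zero
  simp [Subgroup.index_bot] at this

theorem Subgroup.finite_setOf_ge {G : Type u} [Group G] (N : Subgroup G) [N.Normal]
    [N.FiniteIndex] : {M : Subgroup G | N ≤ M}.Finite := by
  have e := QuotientGroup.comapMk'OrderIso N
  have : Finite (Set.Ici N) := Finite.of_equiv _ e.toEquiv
  exact Set.toFinite (Set.Ici N)

/-- `M` is maximal among the closed normal subgroups properly contained in `N`. -/
structure IsMaximalClosedNormal {G : Type u} [Group G] [TopologicalSpace G]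
    (N M : Subgroup G) : Prop where
  normal : M.Normal
  isClosed : IsClosed (M : Set G)
  lt : M < N
  le_of_le : ∀ C : Subgroup G, C.Normal → IsClosed (C : Set G) → C < N → M ≤ C → C ≤ M

/-! ### Generalised obliquity. -/

namespace IsJustInfinite

variable {G : Type u} [Group G] [TopologicalSpace G] [IsTopologicalGroup G] [CompactSpace G]
  [TotallyDisconnectedSpace G]

theorem isOpen (hG : IsJustInfinite G) {N : Subgroup G} (hn : N.Normal)
    (hc : IsClosed (N : Set G)) (h1 : N ≠ ⊥) : IsOpen (N : Set G) :=
  have := hG.2 N hn hc h1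
  N.isOpen_of_isClosed_of_finiteIndex hc

theorem inf_ne_bot (hG : IsJustInfinite G) {M N : Subgroup G} (hM : M.Normal)
    (hMc : IsClosed (M : Set G)) (hM1 : M ≠ ⊥) (hN : N.Normal)
    (hNc : IsClosed (N : Set G)) (hN1 : N ≠ ⊥) : M ⊓ N ≠ ⊥ := by
  have := hG.1
  have := hG.2 M hM hMc hM1
  have := hG.2 N hN hNc hN1
  exact Subgroup.ne_bot_of_finiteIndex _

theorem ne_bot_of_isOpen (hG : IsJustInfinite G) {M : Subgroup G} (h : IsOpen (M : Set G)) :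
    M ≠ ⊥ := by
  have := hG.1
  have := finiteIndex_of_isOpen h
  exact Subgroup.ne_bot_of_finiteIndex _

/-- Closed normal subgroups not contained in a fixed open subgroup satisfy the descending chain
condition. -/
theorem wellFounded_not_le (hG : IsJustInfinite G) {H : Subgroup G} (hH : IsOpen (H : Set G)) :
    WellFounded fun M N : {N : Subgroup G // N.Normal ∧ IsClosed (N : Set G) ∧ ¬ N ≤ H} =>
      M.1 < N.1 := by
  rw [RelEmbedding.wellFounded_iff_isEmpty]
  refine ⟨fun f => ?_⟩
  let N : ℕ → Subgroup G := fun n => (f n).1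
  have hlt : ∀ n, N (n + 1) < N n := fun n => f.map_rel_iff.2 (Nat.lt_succ_self n)
  have hanti : StrictAnti N := strictAnti_nat_of_succ_lt hlt
  -- By compactness of the complement of `H`, a descending chain has nontrivial intersection, hence
  -- of finite index, with only finitely many subgroups above it.
  have hne : (⋂ n, (N n : Set G) ∩ (H : Set G)ᶜ).Nonempty := by
    refine IsCompact.nonempty_iInter_of_sequence_nonempty_isCompact_isClosed _ (fun n => ?_)
      (fun n => ?_) ?_ fun n => ?_
    · exact Set.inter_subset_inter_left _ (hlt n).le
    · obtain ⟨x, hx, hx'⟩ := SetLike.not_le_iff_exists.1 (f n).2.2.2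
      exact ⟨x, hx, hx'⟩
    · exact ((f 0).2.2.1.inter hH.isClosed_compl).isCompact
    · exact (f n).2.2.1.inter hH.isClosed_compl
  obtain ⟨x, hx⟩ := hne
  rw [Set.mem_iInter] at hx
  have hD1 : (⨅ n, N n) ≠ ⊥ := by
    intro h
    have : x ∈ (⨅ n, N n) := by
      rw [Subgroup.mem_iInf]
      exact fun n => (hx n).1
    rw [h, Subgroup.mem_bot] at this
    exact (hx 0).2 (this ▸ H.one_mem)
  have hDn : (⨅ n, N n).Normal := Subgroup.normal_iInf_normal fun n => (f n).2.1
  have hDc : IsClosed ((⨅ n, N n : Subgroup G) : Set G) := by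
    rw [Subgroup.coe_iInf]
    exact isClosed_iInter fun n => (f n).2.2.1
  have := hG.2 _ hDn hDc hD1
  refine Set.infinite_range_of_injective hanti.injective
    ((⨅ n, N n).finite_setOf_ge.subset ?_)
  rintro _ ⟨n, rfl⟩
  exact iInf_le N n

theorem exists_minimal_not_le (hG : IsJustInfinite G) {H : Subgroup G} (hH : IsOpen (H : Set G))
    {N : Subgroup G} (hn : N.Normal) (hc : IsClosed (N : Set G)) (hN : ¬ N ≤ H) :
    ∃ K : Subgroup G, K.Normal ∧ IsClosed (K : Set G) ∧ ¬ K ≤ H ∧ K ≤ N ∧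
      ∀ M : Subgroup G, M.Normal → IsClosed (M : Set G) → M < K → M ≤ H := by
  obtain ⟨K, hK, hmin⟩ := (hG.wellFounded_not_le hH).has_min {K | K.1 ≤ N} ⟨⟨N, hn, hc, hN⟩, le_refl N⟩
  refine ⟨K.1, K.2.1, K.2.2.1, K.2.2.2, hK, fun M hMn hMc hMK => ?_⟩
  by_contra hM
  exact hmin ⟨M, hMn, hMc, hM⟩ (hMK.le.trans hK) hMK

theorem isClosed_of_le (hG : IsJustInfinite G) {M N : Subgroup G} (hM : M.Normal)
    (hMc : IsClosed (M : Set G)) (hM1 : M ≠ ⊥) (h : M ≤ N) : IsClosed (N : Set G) :=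
  N.isClosed_of_isOpen (Subgroup.isOpen_mono h (hG.isOpen hM hMc hM1))

/-- If the maximal subgroups `M` meet nontrivially, their intersection has finite index. Otherwise
choose `K ≤ N` minimal outside an open normal `M₁`, and an `M` not containing `K ⊓ M₁`. Then `N = M
(K ⊓ M₁)` while `K ⊓ M ≤ M₁`, and the modular law puts `K` inside `M₁`. -/
theorem finite_maximal (hG : IsJustInfinite G) {N : Subgroup G} (hn : N.Normal)
    (hc : IsClosed (N : Set G)) (h1 : N ≠ ⊥) :
    {M : Subgroup G | IsMaximalClosedNormal N M}.Finite := by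
  set S := {M : Subgroup G | IsMaximalClosedNormal N M} with hS
  have hJn : (sInf S).Normal := by
    rw [sInf_eq_iInf']
    exact Subgroup.normal_iInf_normal fun M => M.2.normal
  have hJc : IsClosed ((sInf S : Subgroup G) : Set G) := by
    rw [Subgroup.coe_sInf]
    exact isClosed_biInter fun M hM => IsMaximalClosedNormal.isClosed hM
  by_cases hJ : sInf S = ⊥
  · exfalso
    obtain ⟨M₁, hM₁n, hM₁o, hM₁⟩ := exists_isOpen_normal_not_le h1
    have hM₁c := M₁.isClosed_of_isOpen hM₁o
    obtain ⟨K, hKn, hKc, hK, hKN, hmin⟩ := hG.exists_minimal_not_le hM₁o hn hc hM₁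
    have hK1 : K ≠ ⊥ := fun h => hK (h ▸ bot_le)
    have hL : K ⊓ M₁ ≠ ⊥ := hG.inf_ne_bot hKn hKc hK1 hM₁n hM₁c (hG.ne_bot_of_isOpen hM₁o)
    have hLn : (K ⊓ M₁).Normal := inferInstance
    have hLc : IsClosed ((K ⊓ M₁ : Subgroup G) : Set G) := by
      rw [Subgroup.coe_inf]; exact hKc.inter hM₁c
    obtain ⟨M, hM, hLM⟩ : ∃ M, IsMaximalClosedNormal N M ∧ ¬ K ⊓ M₁ ≤ M := by
      by_contra! h
      exact hL (le_bot_iff.1 (hJ ▸ le_sInf h))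
    have hMn := hM.normal
    have hKM : K ⊓ M ≤ M₁ := by
      refine hmin _ inferInstance ?_ ?_
      · rw [Subgroup.coe_inf]; exact hKc.inter hM.isClosed
      · refine lt_of_le_of_ne inf_le_left fun h => hLM ?_
        exact inf_le_left.trans (inf_eq_left.1 h)
    have hsup : M ⊔ (K ⊓ M₁) = N := by
      by_contra hne
      have hle : M ⊔ (K ⊓ M₁) ≤ N := sup_le hM.lt.le (inf_le_left.trans hKN)
      have := hM.le_of_le (M ⊔ (K ⊓ M₁)) inferInstance
        (hG.isClosed_of_le hLn hLc hL le_sup_right) (lt_of_le_of_ne hle hne) le_sup_left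
      exact hLM (le_sup_right.trans this)
    refine hK fun k hk => ?_
    have hk' : k ∈ M ⊔ (K ⊓ M₁) := hsup ▸ hKN hk
    rw [← SetLike.mem_coe, Subgroup.mul_normal] at hk'
    obtain ⟨a, ha, b, hb, rfl⟩ := hk'
    refine M₁.mul_mem (hKM ⟨?_, ha⟩) hb.2
    exact (K.mul_mem_cancel_right hb.1).1 hk
  · have := hG.2 _ hJn hJc hJ
    exact (sInf S).finite_setOf_ge.subset fun M hM => sInf_le hM

theorem exists_maximal_ge (hG : IsJustInfinite G) {M N : Subgroup G} (hM : M.Normal)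
    (hMc : IsClosed (M : Set G)) (hM1 : M ≠ ⊥) (h : M < N) :
    ∃ N', M ≤ N' ∧ IsMaximalClosedNormal N N' := by
  have := hG.2 _ hM hMc hM1
  have hfin : {C : Subgroup G | M ≤ C ∧ C.Normal ∧ IsClosed (C : Set G) ∧ C < N}.Finite :=
    M.finite_setOf_ge.subset fun C hC => hC.1
  obtain ⟨N', hMN', hN'⟩ := hfin.exists_le_maximal (a := M) ⟨le_rfl, hM, hMc, h⟩
  exact ⟨N', hMN', hN'.prop.2.1, hN'.prop.2.2.1, hN'.prop.2.2.2, fun C hC hCc hlt hle =>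
    hN'.2 ⟨hMN'.trans hle, hC, hCc, hlt⟩ hle⟩

/-- Generalised obliquity: an open subgroup of a just infinite profinite group contains all but
finitely many closed normal subgroups. -/
theorem finite_not_le (hG : IsJustInfinite G) {H : Subgroup G} (hH : IsOpen (H : Set G)) :
    {N : Subgroup G | N.Normal ∧ IsClosed (N : Set G) ∧ ¬ N ≤ H}.Finite := by
  -- A König argument: each `N` has finitely many maximal closed normal subgroups, each nontrivial
  -- `M < N` lies in one of them, and descent outside `H` terminates.
  have key : ∀ N : {N : Subgroup G // N.Normal ∧ IsClosed (N : Set G) ∧ ¬ N ≤ H},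
      {M : Subgroup G | (M.Normal ∧ IsClosed (M : Set G) ∧ ¬ M ≤ H) ∧ M ≤ N.1}.Finite := by
    intro N
    induction N using (hG.wellFounded_not_le hH).induction with
    | _ N ih =>
    have hN1 : N.1 ≠ ⊥ := fun h => N.2.2.2 (h ▸ bot_le)
    have hfin := (hG.finite_maximal N.2.1 N.2.2.1 hN1)
    refine ((Set.finite_singleton N.1).union (Set.Finite.biUnion' (hfin.inter_of_left {M | ¬ M ≤ H})
      (t := fun N' _ => {M : Subgroup G | (M.Normal ∧ IsClosed (M : Set G) ∧ ¬ M ≤ H) ∧ M ≤ N'})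
      fun N' hN' => ?_)).subset ?_
    · obtain ⟨hN', hN'H⟩ := hN'
      exact ih ⟨N', IsMaximalClosedNormal.normal hN', IsMaximalClosedNormal.isClosed hN', hN'H⟩
        (IsMaximalClosedNormal.lt hN')
    · rintro M ⟨hM, hMN⟩
      rcases hMN.eq_or_lt with rfl | hlt
      · exact Or.inl rfl
      · obtain ⟨N', hMN', hN'⟩ := hG.exists_maximal_ge hM.1 hM.2.1
          (fun h => hM.2.2 (h ▸ bot_le)) hlt
        refine Or.inr ?_
        simp only [Set.mem_iUnion]
        exact ⟨N', ⟨hN', fun h => hM.2.2 (hMN'.trans h)⟩, hM, hMN'⟩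
  by_cases h : (⊤ : Subgroup G) ≤ H
  · convert Set.finite_empty
    ext N
    simp [top_le_iff.1 h]
  · exact (key ⟨⊤, inferInstance, isClosed_univ, h⟩).subset fun M hM => ⟨hM, le_top⟩

end IsJustInfinite

/-! ### Centres of finite index and the abelian case. -/

theorem Subgroup.finite_commutatorSet_of_finiteIndex_center (G : Type u) [Group G]
    [(Subgroup.center G).FiniteIndex] : Finite (commutatorSet G) := by
  let f : (G ⧸ Subgroup.center G) × (G ⧸ Subgroup.center G) → G := fun p =>
    p.1.out * p.2.out * p.1.out⁻¹ * p.2.out⁻¹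
  refine ((Set.finite_range f).subset ?_).to_subtype
  rintro _ ⟨a, b, rfl⟩
  refine ⟨(a, b), ?_⟩
  obtain ⟨⟨z, hz⟩, hz'⟩ := QuotientGroup.mk_out_eq_mul (Subgroup.center G) a
  obtain ⟨⟨w, hw⟩, hw'⟩ := QuotientGroup.mk_out_eq_mul (Subgroup.center G) b
  change (a : G ⧸ Subgroup.center G).out * (b : G ⧸ Subgroup.center G).out *
    (a : G ⧸ Subgroup.center G).out⁻¹ * (b : G ⧸ Subgroup.center G).out⁻¹ = a * b * a⁻¹ * b⁻¹
  simp only [hz', hw']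
  rw [Subgroup.mem_center_iff] at hz hw
  calc a * z * (b * w) * (a * z)⁻¹ * (b * w)⁻¹
      = a * (z * (b * w)) * z⁻¹ * a⁻¹ * w⁻¹ * b⁻¹ := by group
    _ = a * b * (w * a⁻¹) * w⁻¹ * b⁻¹ := by rw [← hz]; group
    _ = a * b * a⁻¹ * b⁻¹ := by rw [← hw]; group

namespace IsJustInfinite

variable {G : Type u} [Group G] [TopologicalSpace G] [IsTopologicalGroup G] [CompactSpace G]
  [TotallyDisconnectedSpace G]

theorem infinite_of_normal (hG : IsJustInfinite G) {N : Subgroup G} (hn : N.Normal)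
    (h1 : N ≠ ⊥) : Infinite N := by
  by_contra h
  rw [not_infinite_iff_finite] at h
  have := hG.1
  have hc : IsClosed (N : Set G) := (Set.toFinite (N : Set G)).isClosed
  have := hG.2 N hn hc h1
  have hb : (⊥ : Subgroup G).FiniteIndex := by
    refine ⟨?_⟩
    rw [← Subgroup.relIndex_mul_index (bot_le : ⊥ ≤ N)]
    refine mul_ne_zero ?_ this.index_ne_zero
    rw [Subgroup.relIndex_bot_left]
    exact Nat.card_pos.ne'
  exact (⊥ : Subgroup G).ne_bot_of_finiteIndex rfl

/-- By Schur's theorem `⁅U, U⁆` is finite, and a just infinite group has no nontrivial finite normal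
subgroup. -/
theorem commute_of_finiteIndex_center (hG : IsJustInfinite G) {U : Subgroup G} (hU : U.Normal)
    [(Subgroup.center U).FiniteIndex] : ∀ a ∈ U, ∀ b ∈ U, a * b = b * a := by
  have := Subgroup.finite_commutatorSet_of_finiteIndex_center U
  have hfin : Finite (⁅U, U⁆ : Subgroup G) := by
    rw [← Subgroup.map_subtype_commutator]
    have : Finite (_root_.commutator U) := inferInstance
    exact Finite.Set.finite_image ((_root_.commutator U : Subgroup U) : Set U) U.subtype
  have hbot : ⁅U, U⁆ = ⊥ := by
    by_contra h
    exact not_finite_iff_infinite.2 (hG.infinite_of_normal inferInstance h) hfin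
  rw [Subgroup.commutator_eq_bot_iff_le_centralizer] at hbot
  exact fun a ha b hb => (Subgroup.mem_centralizer_iff.1 (hbot ha) b hb).symm

/-- `U` is torsion-free, and the closure of some `⟨x⟩` has finite index `m`. The `m`-th power map is
injective, so `E = D ^ m` is open and `U ^ m ≤ ⟨x⟩ E`. Thus `u ↦ u ^ m` embeds `U/D` in the cyclic
group `⟨x⟩ E/E`. -/
theorem isCyclic_quotient {U : Type u} [CommGroup U] [TopologicalSpace U] [IsTopologicalGroup U]
    [CompactSpace U] [TotallyDisconnectedSpace U] (hU : IsJustInfinite U) {D : Subgroup U}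
    (hD : IsOpen (D : Set U)) : IsCyclic (U ⧸ D) := by
  have hinf := hU.1
  have htf : ∀ x : U, ∀ m : ℕ, m ≠ 0 → x ^ m = 1 → x = 1 := by
    intro x m hm hx
    by_contra h1
    have hne : Subgroup.zpowers x ≠ ⊥ := by rwa [Ne, Subgroup.zpowers_eq_bot]
    have := hU.infinite_of_normal inferInstance hne
    have hfo : IsOfFinOrder x := isOfFinOrder_iff_pow_eq_one.2 ⟨m, Nat.pos_of_ne_zero hm, hx⟩
    exact this.not_finite (Set.Finite.to_subtype (finite_zpowers.2 hfo))
  obtain ⟨x, hx⟩ := exists_ne (1 : U)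
  set C := (Subgroup.zpowers x).topologicalClosure with hC
  have hC1 : C ≠ ⊥ := fun h => hx <| by
    have := Subgroup.le_topologicalClosure _ (Subgroup.mem_zpowers x)
    rwa [← hC, h, Subgroup.mem_bot] at this
  have hCf := hU.2 C inferInstance (Subgroup.isClosed_topologicalClosure _) hC1
  set m := C.index with hm
  have hm0 : m ≠ 0 := hCf.index_ne_zero
  have hinj : Function.Injective (powMonoidHom m : U →* U) := by
    rw [injective_iff_map_eq_one]
    exact fun a ha => htf a m hm0 ha
  set E := D.map (powMonoidHom m) with hE
  have hEc : IsClosed (E : Set U) := by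
    rw [hE, Subgroup.coe_map]
    exact ((D.isClosed_of_isOpen hD).isCompact.image (continuous_pow m)).isClosed
  have hE1 : E ≠ ⊥ := by
    rw [hE, Ne, Subgroup.map_eq_bot_iff_of_injective _ hinj]
    exact hU.ne_bot_of_isOpen hD
  have hEo : IsOpen (E : Set U) := hU.isOpen inferInstance hEc hE1
  have hCle : C ≤ Subgroup.zpowers x ⊔ E :=
    Subgroup.topologicalClosure_minimal _ le_sup_left
      (Subgroup.isClosed_of_isOpen _ (Subgroup.isOpen_mono le_sup_right hEo))
  let φ : U →* U ⧸ E := (QuotientGroup.mk' E).comp (powMonoidHom m)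
  have hφ : ∀ u, φ u ∈ Subgroup.zpowers (QuotientGroup.mk' E x) := by
    intro u
    have hu : u ^ m ∈ Subgroup.zpowers x ⊔ E := hCle (C.pow_index_mem u)
    rw [← MonoidHom.map_zpowers]
    have := Subgroup.mem_map_of_mem (QuotientGroup.mk' E) hu
    rwa [Subgroup.map_sup, QuotientGroup.map_mk'_self, sup_bot_eq] at this
  let ψ : U ⧸ D →* Subgroup.zpowers (QuotientGroup.mk' E x) :=
    QuotientGroup.lift D (φ.codRestrict _ hφ) fun d hd => by
      ext
      exact (QuotientGroup.eq_one_iff _).2 (Subgroup.mem_map_of_mem _ hd)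
  refine isCyclic_of_injective ψ ?_
  rw [injective_iff_map_eq_one]
  intro a
  induction a using QuotientGroup.induction_on with
  | _ u =>
  intro hu
  have : φ u = 1 := congrArg Subtype.val hu
  obtain ⟨d, hd, hdu⟩ := (QuotientGroup.eq_one_iff _).1 this
  rw [hinj hdu] at hd
  exact (QuotientGroup.eq_one_iff _).2 hd

end IsJustInfinite

/-- Conjugation acts on the cyclic group `U/D` as a power map, which preserves every subgroup. -/
theorem Subgroup.normal_of_isCyclic_quotient {G : Type u} [Group G] {U D V : Subgroup G}
    [U.Normal] [D.Normal] [IsCyclic (U ⧸ D.subgroupOf U)] (hDV : D ≤ V) (hVU : V ≤ U) :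
    V.Normal := by
  refine ⟨fun v hv g => ?_⟩
  let σ : U ⧸ D.subgroupOf U →* U ⧸ D.subgroupOf U :=
    QuotientGroup.map _ _ (MulAut.conjNormal g : MulAut U).toMonoidHom fun d hd => by
      rw [Subgroup.mem_comap, Subgroup.mem_subgroupOf]
      simpa using! Subgroup.Normal.conj_mem ‹D.Normal› _ (Subgroup.mem_subgroupOf.1 hd) g
  obtain ⟨k, hk⟩ := σ.map_cyclic
  have := hk (QuotientGroup.mk ⟨v, hVU hv⟩)
  rw [← QuotientGroup.mk_zpow] at this
  have := (QuotientGroup.eq.1 this)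
  rw [Subgroup.mem_subgroupOf] at this
  have h2 : (g * v * g⁻¹)⁻¹ * v ^ k ∈ D := by simpa using! this
  have h3 := V.mul_mem (V.zpow_mem hv k) (V.inv_mem (hDV h2))
  simpa using h3

/-! ### Conjugates of a subgroup and their join. -/

section Conjugates

variable {G : Type u} [Group G]

theorem Subgroup.Normal.conj_smul_le {U V : Subgroup G} (hU : U.Normal) (h : V ≤ U) (g : G) :
    MulAut.conj g • V ≤ U := by
  have := Subgroup.pointwise_smul_le_pointwise_smul_iff (a := MulAut.conj g).2 h
  rwa [hU.conj_smul_eq_self] at this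

theorem Subgroup.le_iSup_conj (V : Subgroup G) : V ≤ ⨆ g : G, MulAut.conj g • V :=
  le_iSup_of_le 1 (by simp)

theorem Subgroup.normal_iSup_conj (V : Subgroup G) : (⨆ g : G, MulAut.conj g • V).Normal := by
  refine Subgroup.Normal.of_conjugate_fixed fun h => ?_
  refine le_antisymm ?_ ?_
  · rw [Subgroup.pointwise_smul_subset_iff]
    refine iSup_le fun g => ?_
    rw [← Subgroup.pointwise_smul_subset_iff, smul_smul, ← map_mul]
    exact le_iSup (fun g : G => MulAut.conj g • V) (h * g)
  · refine iSup_le fun g => ?_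
    rw [Subgroup.subset_pointwise_smul_iff, smul_smul, ← map_inv, ← map_mul]
    exact le_iSup (fun g : G => MulAut.conj g • V) (h⁻¹ * g)

theorem Subgroup.map_conj_smul {H : Type*} [Group H] (f : G →* H) (V : Subgroup G) (g : G) :
    (MulAut.conj g • V).map f = MulAut.conj (f g) • V.map f := by
  ext x
  simp only [Subgroup.mem_map, Subgroup.mem_smul_pointwise_iff_exists, MulAut.smul_def,
    MulAut.conj_apply]
  constructor
  · rintro ⟨_, ⟨v, hv, rfl⟩, rfl⟩
    exact ⟨f v, ⟨v, hv, rfl⟩, by simp⟩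
  · rintro ⟨_, ⟨v, hv, rfl⟩, rfl⟩
    exact ⟨_, ⟨v, hv, rfl⟩, by simp⟩

theorem Subgroup.comap_conj_smul {H : Type*} [Group H] (f : G →* H) (V : Subgroup H) (g : G) :
    (MulAut.conj (f g) • V).comap f = MulAut.conj g • V.comap f := by
  ext x
  simp [Subgroup.mem_pointwise_smul_iff_inv_smul_mem, ← map_inv]

/-- A subgroup whose distinct conjugates commute modulo `K ≤ V` is normal in the subgroup generated
by its conjugates. -/
theorem Subgroup.iSup_conj_le_normalizer {K V : Subgroup G} (hKV : K ≤ V)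
    (hcomm : ∀ g : G, MulAut.conj g • V ≠ V → ⁅MulAut.conj g • V, V⁆ ≤ K) :
    ⨆ g : G, MulAut.conj g • V ≤ Subgroup.normalizer (V : Set G) := by
  refine iSup_le fun g => ?_
  by_cases hg : MulAut.conj g • V = V
  · rw [hg]
    exact Subgroup.le_normalizer
  · exact Subgroup.le_normalizer_iff_commutator_le_right.2 ((hcomm g hg).trans hKV)

end Conjugates

/-! ### Basal indecomposability of quotients by small kernels. -/

section Topology

variable {G : Type u} [Group G] [TopologicalSpace G] [IsTopologicalGroup G] [CompactSpace G]
  [TotallyDisconnectedSpace G]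

theorem isOpen_normalCore {V : Subgroup G} (hV : IsOpen (V : Set G)) :
    IsOpen (V.normalCore : Set G) := by
  obtain ⟨W, hn, ho, hW⟩ := exists_isOpen_normal_le hV
  exact Subgroup.isOpen_mono (Subgroup.normal_le_normalCore.2 hW) ho

theorem finiteIndex_subgroupOf_of_isOpen {V U : Subgroup G} (hV : IsOpen (V : Set G)) :
    (V.subgroupOf U).FiniteIndex :=
  have := finiteIndex_of_isOpen hV
  inferInstance

/-- The core `D` of `V` lies in every conjugate, and each conjugate commutes with some other one, so
`D` centralizes `U`. Hence `U` has centre of finite index and is abelian, `U/D` is cyclic, and `V`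
is normal in `G`; but then its conjugates cannot generate more than `V`. -/
theorem IsHereditarilyJustInfinite.not_conj_generate (hG : IsHereditarilyJustInfinite G)
    {U V : Subgroup G} (hU : U.Normal) (hUo : IsOpen (U : Set G)) (hVo : IsOpen (V : Set G))
    (hVU : V < U) (hgen : ⨆ g : G, MulAut.conj g • V = U)
    (hcomm : ∀ g h : G, MulAut.conj g • V ≠ MulAut.conj h • V →
      ⁅MulAut.conj g • V, MulAut.conj h • V⁆ = ⊥) : False := by
  have hVn : ¬ V.Normal := by
    intro hVn
    refine hVU.ne (hgen ▸ le_antisymm V.le_iSup_conj ?_)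
    exact iSup_le fun g => by rw [hVn.conj_smul_eq_self]
  set D := V.normalCore with hD
  have hDo : IsOpen (D : Set G) := isOpen_normalCore hVo
  have hDn : D.Normal := inferInstance
  have hDV : D ≤ V := V.normalCore_le
  have hDg : ∀ g : G, D ≤ MulAut.conj g • V := fun g => by
    rw [← hDn.conj_smul_eq_self g]
    exact Subgroup.pointwise_smul_le_pointwise_smul_iff.2 hDV
  have hDU : D ≤ Subgroup.centralizer (U : Set G) := by
    rw [← Subgroup.le_centralizer_iff, ← hgen]
    refine iSup_le fun g => ?_
    obtain ⟨h, hh⟩ : ∃ h : G, MulAut.conj g • V ≠ MulAut.conj h • V := by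
      by_contra! hcon
      refine hVn (Subgroup.Normal.of_conjugate_fixed fun h => ?_)
      rw [← hcon h, hcon 1]
      simp
    rw [Subgroup.le_centralizer_iff]
    refine (hDg h).trans ?_
    rw [← Subgroup.le_centralizer_iff, ← Subgroup.commutator_eq_bot_iff_le_centralizer]
    exact hcomm g h hh
  have hfc : (Subgroup.center U).FiniteIndex := by
    have := finiteIndex_subgroupOf_of_isOpen (U := U) hDo
    refine Subgroup.finiteIndex_of_le (H := D.subgroupOf U) fun d hd => ?_
    rw [Subgroup.mem_center_iff]
    intro u
    exact Subtype.ext (Subgroup.mem_centralizer_iff.1 (hDU (Subgroup.mem_subgroupOf.1 hd)) u u.2)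
  have hab := hG.1.commute_of_finiteIndex_center hU
  have hUJ := hG.2 U hUo
  have hcU : CompactSpace U :=
    isCompact_iff_compactSpace.mp (U.isClosed_of_isOpen hUo).isCompact
  let _ : CommGroup U :=
    { (inferInstance : Group U) with
      mul_comm := fun a b => Subtype.ext (hab a a.2 b b.2) }
  have hcyc : IsCyclic (U ⧸ D.subgroupOf U) :=
    hUJ.isCyclic_quotient (D := D.subgroupOf U) (hDo.preimage continuous_subtype_val)
  exact hVn (Subgroup.normal_of_isCyclic_quotient hDV hVU.le)

theorem IsJustInfinite.finite_normal_subgroupOf {U W : Subgroup G} (hU : IsJustInfinite U)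
    (hUo : IsOpen (U : Set G)) (hWo : IsOpen (W : Set G)) :
    {V : Subgroup G | V ≤ U ∧ (V.subgroupOf U).Normal ∧ IsClosed (V : Set G) ∧
      ¬ V ≤ W}.Finite := by
  have hcU : CompactSpace U :=
    isCompact_iff_compactSpace.mp (U.isClosed_of_isOpen hUo).isCompact
  have hfin := hU.finite_not_le (H := W.subgroupOf U) (hWo.preimage continuous_subtype_val)
  refine (hfin.image (Subgroup.map U.subtype)).subset ?_
  rintro V ⟨hVU, hn, hc, hVW⟩
  refine ⟨V.subgroupOf U, ⟨hn, hc.preimage continuous_subtype_val, fun h => hVW fun v hv => ?_⟩, ?_⟩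
  · exact h (show (⟨v, hVU hv⟩ : U) ∈ V.subgroupOf U from hv)
  · exact Subgroup.map_subgroupOf_eq_of_le hVU

theorem exists_isOpen_normal_lt [Infinite G] {U : Subgroup G} (hUo : IsOpen (U : Set G)) :
    ∃ W : Subgroup G, W.Normal ∧ IsOpen (W : Set G) ∧ W < U := by
  have := finiteIndex_of_isOpen hUo
  obtain ⟨W, hn, ho, hW⟩ := exists_isOpen_normal_not_le U.ne_bot_of_finiteIndex
  obtain ⟨W', hn', ho', hW'⟩ := exists_isOpen_normal_le
    (H := W ⊓ U) (by rw [Subgroup.coe_inf]; exact ho.inter hUo)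
  refine ⟨W', hn', ho', lt_of_le_of_ne (hW'.trans inf_le_right) ?_⟩
  rintro rfl
  exact hW (hW'.trans inf_le_left)

/-- The condition that `V`, modulo `K`, generates `U` as a basal central product. -/
def IsBasalModulo (U K V : Subgroup G) : Prop :=
  K ≤ V ∧ V < U ∧ ⨆ g : G, MulAut.conj g • V = U ∧
    ∀ g h : G, MulAut.conj g • V ≠ MulAut.conj h • V →
      ⁅MulAut.conj g • V, MulAut.conj h • V⁆ ≤ K

theorem exists_isBasalModulo {Q : Type u} [Group Q] {f : G →* Q} (hfs : Function.Surjective f)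
    {U : Subgroup G} (hKU : f.ker ≤ U) (h : ¬ IsBasallyCentrallyIndecomposable (U.map f)) :
    ∃ V, IsBasalModulo U f.ker V := by
  rw [IsBasallyCentrallyIndecomposable, not_not] at h
  obtain ⟨_, ⟨-, ⟨hsup, hcomm⟩, V, rfl⟩, hlt⟩ := h
  have hker : ∀ X : Subgroup Q, f.ker ≤ X.comap f := fun X => Subgroup.comap_mono bot_le
  have hcU : (U.map f).comap f = U := by
    rw [Subgroup.comap_map_eq, sup_eq_left]
    exact hKU
  have hconj : ∀ g : G, (MulAut.conj g • V.comap f).map f = MulAut.conj (f g) • V := fun g => by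
    rw [Subgroup.map_conj_smul, Subgroup.map_comap_eq_self_of_surjective hfs]
  have hle : V ≤ U.map f := by simpa using (hlt _ ⟨1, rfl⟩).le
  have hne : V ≠ U.map f := by simpa using (hlt _ ⟨1, rfl⟩).ne
  refine ⟨V.comap f, hker V, lt_of_le_of_ne ?_ ?_, ?_, fun g h hgh => ?_⟩
  · rw [← hcU]
    exact Subgroup.comap_mono hle
  · intro h
    rw [← hcU] at h
    exact hne (Subgroup.comap_injective hfs h)
  · have h1 : (⨆ g : G, MulAut.conj g • V.comap f).map f = U.map f := by
      rw [Subgroup.map_iSup, ← hsup, sSup_range]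
      simp only [hconj]
      exact hfs.iSup_comp (g := fun x => MulAut.conj x • V)
    have h2 : f.ker ≤ ⨆ g : G, MulAut.conj g • V.comap f :=
      (hker V).trans (V.comap f).le_iSup_conj
    rw [← hcU, ← h1, Subgroup.comap_map_eq, sup_eq_left.2 h2]
  · have := hcomm _ ⟨f g, rfl⟩ _ ⟨f h, rfl⟩ fun heq => hgh ?_
    · simp only at this
      rw [← hconj, ← hconj, ← Subgroup.map_commutator, Subgroup.map_eq_bot_iff] at this
      exact this
    · simp only at heq
      rw [← Subgroup.comap_conj_smul, heq, Subgroup.comap_conj_smul]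

theorem exists_isOpen_normal_not_ge {N : Subgroup G} (hN : N ≠ ⊥) :
    ∃ E : Subgroup G, E.Normal ∧ IsOpen (E : Set G) ∧ ∀ K ≤ E, ¬ N ≤ K := by
  obtain ⟨E, hn, ho, hE⟩ := exists_isOpen_normal_not_le hN
  exact ⟨E, hn, ho, fun K hK h => hE (h.trans hK)⟩

theorem IsHereditarilyJustInfinite.eventually_indecomposable (hG : IsHereditarilyJustInfinite G)
    {U : Subgroup G} (hU : U.Normal) (hUo : IsOpen (U : Set G)) :
    ∃ E : Subgroup G, IsOpen (E : Set G) ∧ ∀ {Q : Type u} [Group Q] (f : G →* Q),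
      Function.Surjective f → IsOpen (f.ker : Set G) → f.ker ≤ E → f.ker ≤ U →
        IsBasallyCentrallyIndecomposable (U.map f) := by
  have := hG.1.1
  -- A candidate `V` is normal in `U`, and it is not inside `W`, since its conjugates generate `U`.
  -- Obliquity in `U` leaves finitely many.
  obtain ⟨W, hWn, hWo, hWU⟩ := exists_isOpen_normal_lt hUo
  have hfin := (hG.2 U hUo).finite_normal_subgroupOf hUo hWo
  have hV : ∀ V : Subgroup G, ∃ E : Subgroup G, IsOpen (E : Set G) ∧
      ∀ K ≤ E, IsOpen (K : Set G) → ¬ IsBasalModulo U K V := by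
    intro V
    by_cases hcon : IsOpen (V : Set G) ∧ V < U ∧ ⨆ g : G, MulAut.conj g • V = U
    · obtain ⟨hVo, hVU, hgen⟩ := hcon
      obtain ⟨g, h, hgh, hne⟩ : ∃ g h : G, MulAut.conj g • V ≠ MulAut.conj h • V ∧
          ⁅MulAut.conj g • V, MulAut.conj h • V⁆ ≠ ⊥ := by
        by_contra! hcon
        exact hG.not_conj_generate hU hUo hVo hVU hgen hcon
      obtain ⟨E, -, hEo, hE⟩ := exists_isOpen_normal_not_ge hne
      exact ⟨E, hEo, fun K hK _ hb => hE K hK (hb.2.2.2 g h hgh)⟩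
    · exact ⟨⊤, isOpen_univ, fun K _ hKo hb =>
        hcon ⟨Subgroup.isOpen_mono hb.1 hKo, hb.2.1, hb.2.2.1⟩⟩
  choose E hEo hE using hV
  refine ⟨⨅ V ∈ hfin.toFinset, E V, ?_, fun f hf hKo hKE hKU => ?_⟩
  · simp only [Subgroup.coe_iInf]
    exact isOpen_biInter_finset fun V _ => hEo V
  · by_contra hcon
    obtain ⟨V, hb⟩ := exists_isBasalModulo hf hKU hcon
    refine hE V f.ker (hKE.trans (iInf₂_le V ?_)) hKo hb
    rw [Set.Finite.mem_toFinset]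
    obtain ⟨hKV, hVU, hgen, hcomm⟩ := hb
    refine ⟨hVU.le, ?_, V.isClosed_of_isOpen (Subgroup.isOpen_mono hKV hKo), fun hVW => ?_⟩
    · rw [Subgroup.normal_subgroupOf_iff_le_normalizer hVU.le, ← hgen]
      refine Subgroup.iSup_conj_le_normalizer hKV fun g hg => ?_
      simpa using hcomm g 1 (by simpa using hg)
    · refine hWU.not_ge (hgen ▸ iSup_le fun g => hWn.conj_smul_le hVW g)

end Topology

namespace ChiefFactor

variable {G : Type u} [Group G] [TopologicalSpace G]

theorem ext_top_bot {c d : ChiefFactor G} (h1 : c.top = d.top) (h2 : c.bot = d.bot) : c = d := by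
  cases c
  cases d
  simp_all

theorem isMaximalClosedNormal (c : ChiefFactor G) : IsMaximalClosedNormal c.top c.bot where
  normal := c.bot_normal
  isClosed := c.bot_closed
  lt := c.bot_lt_top
  le_of_le C hC hCc hlt hle := by
    by_contra h
    exact c.chief C hC hCc ⟨lt_of_le_not_ge hle h, hlt⟩

end ChiefFactor

/-! ### Deep chief factors and the descending chain. -/

section Construction

variable {G : Type u} [Group G] [TopologicalSpace G] [IsTopologicalGroup G] [CompactSpace G]
  [TotallyDisconnectedSpace G]

theorem IsJustInfinite.finite_chiefFactor_not_le (hG : IsJustInfinite G) {H : Subgroup G}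
    (hH : IsOpen (H : Set G)) : {c : ChiefFactor G | ¬ c.top ≤ H}.Finite := by
  have hfin := Set.Finite.biUnion' (hG.finite_not_le hH)
    (t := fun R _ => (fun S => (R, S)) '' {S : Subgroup G | IsMaximalClosedNormal R S})
    fun R hR => (hG.finite_maximal hR.1 hR.2.1 fun h => hR.2.2 (h ▸ bot_le)).image _
  refine Set.Finite.of_finite_image (f := fun c : ChiefFactor G => (c.top, c.bot))
    (hfin.subset ?_) ?_
  · rintro _ ⟨c, hc, rfl⟩
    simp only [Set.mem_iUnion]
    exact ⟨c.top, ⟨c.top_normal, c.top_closed, hc⟩, c.bot, c.isMaximalClosedNormal, rfl⟩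
  · intro c _ d _ h
    exact ChiefFactor.ext_top_bot (congrArg Prod.fst h) (congrArg Prod.snd h)

/-- There is no minimal closed normal subgroup: intersecting with a suitable open normal subgroup
gives a smaller nontrivial one. -/
theorem IsJustInfinite.chiefFactor_bot_ne_bot (hG : IsJustInfinite G) (c : ChiefFactor G) :
    c.bot ≠ ⊥ := by
  intro h
  have htop : c.top ≠ ⊥ := fun h' => c.bot_lt_top.ne (h.trans h'.symm)
  obtain ⟨W, hn, ho, hW⟩ := exists_isOpen_normal_not_le htop
  have hWc := W.isClosed_of_isOpen ho
  have := c.top_normal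
  refine c.chief (c.top ⊓ W) inferInstance ?_ ⟨?_, ?_⟩
  · rw [Subgroup.coe_inf]
    exact c.top_closed.inter hWc
  · rw [h, bot_lt_iff_ne_bot]
    exact hG.inf_ne_bot c.top_normal c.top_closed htop hn hWc (hG.ne_bot_of_isOpen ho)
  · exact lt_of_le_of_ne inf_le_left fun h => hW (inf_eq_left.1 h)

/-- One step in the construction of an inverse system for a hereditarily just infinite group:
`(B', K')` is a chief factor below `H` in the class `𝒞`, placed sufficiently deep relative
to `B`. -/
structure IsDeepChiefFactor (𝒞 : FiniteGroupClass.{u}) (B H B' K' : Subgroup G) : Prop where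
  normal_top : B'.Normal
  normal_bot : K'.Normal
  isOpen_bot : IsOpen (K' : Set G)
  lt : K' < B'
  le : B' ≤ H
  le_or_le : ∀ N : Subgroup G, N.Normal → K' ≤ N → B' ≤ N ∨ N ≤ B
  le_of_lt : ∀ N : Subgroup G, N.Normal → IsClosed (N : Set G) → N < B' → N ≤ K'
  mem : ∀ {Q : Type u} [Group Q] (f : G →* Q), f.ker = K' → 𝒞.Mem (B'.map f)
  indecomposable : ∀ {Q : Type u} [Group Q] (f : G →* Q), Function.Surjective f → f.ker = K' →
    ∀ U : Subgroup G, U.Normal → B ≤ U → IsBasallyCentrallyIndecomposable (U.map f)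

/-- Second isomorphism theorem: `B/(B ⊓ c.bot) ≅ c.top/c.bot`. -/
theorem ChiefFactor.mem_map (𝒞 : FiniteGroupClass.{u}) (c : ChiefFactor G) (hc : 𝒞.Mem c.Quotient)
    {B : Subgroup G} (hB : B ≤ c.top) (hsup : B ⊔ c.bot = c.top) {Q : Type u} [Group Q]
    (f : G →* Q) (hf : f.ker = B ⊓ c.bot) : 𝒞.Mem (B.map f) := by
  have := c.bot_normal
  let φ : B →* c.Quotient := (QuotientGroup.mk' _).comp (Subgroup.inclusion hB)
  have hφ : Function.Surjective φ := by
    intro q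
    induction q using QuotientGroup.induction_on with
    | _ r =>
    have hr : (r : G) ∈ B ⊔ c.bot := by
      rw [hsup]
      exact r.2
    rw [← SetLike.mem_coe, Subgroup.mul_normal] at hr
    obtain ⟨b, hb, s, hs, hbs⟩ := hr
    refine ⟨⟨b, hb⟩, QuotientGroup.eq.2 ?_⟩
    rw [Subgroup.mem_subgroupOf]
    have : b⁻¹ * (r : G) = s := by rw [← hbs]; simp
    simpa [this] using! hs
  have hker : (f.subgroupMap B).ker = φ.ker := by
    ext b
    have h1 : b ∈ (f.subgroupMap B).ker ↔ (b : G) ∈ f.ker := by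
      rw [MonoidHom.mem_ker, MonoidHom.mem_ker, Subtype.ext_iff]
      rfl
    have h2 : b ∈ φ.ker ↔ (b : G) ∈ c.bot := by
      rw [MonoidHom.mem_ker]
      exact QuotientGroup.eq_one_iff _
    rw [h1, h2, hf]
    exact ⟨fun h => h.2, fun h => ⟨b.2, h⟩⟩
  refine 𝒞.mem_of_mulEquiv _ _ ?_ hc
  exact ((QuotientGroup.quotientKerEquivOfSurjective φ hφ).symm.trans
    (QuotientGroup.quotientMulEquivOfEq hker.symm)).trans
    (QuotientGroup.quotientKerEquivOfSurjective _ (f.subgroupMap_surjective B))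

theorem IsHereditarilyJustInfinite.exists_isDeepChiefFactor (hG : IsHereditarilyJustInfinite G)
    (𝒞 : FiniteGroupClass.{u}) (h𝒞 : {c : ChiefFactor G | 𝒞.Mem c.Quotient}.Infinite)
    {B H : Subgroup G} (hB : B.Normal) (hBo : IsOpen (B : Set G)) (hHo : IsOpen (H : Set G)) :
    ∃ B' K', IsDeepChiefFactor 𝒞 B H B' K' := by
  have hBfi := finiteIndex_of_isOpen hBo
  have hfinN := hG.1.finite_not_le hBo
  have hfinU : {U : Subgroup G | B ≤ U}.Finite := B.finite_setOf_ge
  have hE : ∀ U : Subgroup G, ∃ E : Subgroup G, IsOpen (E : Set G) ∧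
      (U.Normal → B ≤ U → ∀ {Q : Type u} [Group Q] (f : G →* Q),
      Function.Surjective f → IsOpen (f.ker : Set G) → f.ker ≤ E → f.ker ≤ U →
        IsBasallyCentrallyIndecomposable (U.map f)) := by
    intro U
    by_cases h : U.Normal ∧ B ≤ U
    · obtain ⟨E, hEo, hE⟩ := hG.eventually_indecomposable h.1 (Subgroup.isOpen_mono h.2 hBo)
      exact ⟨E, hEo, fun _ _ => hE⟩
    · exact ⟨⊤, isOpen_univ, fun h1 h2 => absurd ⟨h1, h2⟩ h⟩
  choose E hEo hE using hE
  -- Lying below every `N` not inside `B` yields `le_or_le`; lying below each `E U` yields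
  -- indecomposability. Both families are finite, so `H'` is open.
  set H' : Subgroup G := (H ⊓ B) ⊓ ((⨅ N ∈ hfinN.toFinset, N) ⊓ ⨅ U ∈ hfinU.toFinset, E U) with hH'
  have hH'o : IsOpen (H' : Set G) := by
    simp only [hH', Subgroup.coe_inf, Subgroup.coe_iInf]
    refine (hHo.inter hBo).inter ((isOpen_biInter_finset fun N hN => ?_).inter
      (isOpen_biInter_finset fun U _ => hEo U))
    rw [Set.Finite.mem_toFinset] at hN
    exact hG.1.isOpen hN.1 hN.2.1 fun h => hN.2.2 (h ▸ bot_le)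
  obtain ⟨c, hc, hcH⟩ := (h𝒞.sdiff (hG.1.finite_chiefFactor_not_le hH'o)).nonempty
  rw [Set.mem_ofPred_eq, not_not] at hcH
  have hS := hG.1.chiefFactor_bot_ne_bot c
  have hSo := hG.1.isOpen c.bot_normal c.bot_closed hS
  obtain ⟨B', hBn, hBc, hBS, hBR, hmin⟩ :=
    hG.1.exists_minimal_not_le hSo c.top_normal c.top_closed c.bot_lt_top.not_ge
  have hSn := c.bot_normal
  have hB'H : B' ≤ H' := hBR.trans hcH
  have hB'1 : B' ≠ ⊥ := fun h => hBS (h ▸ bot_le)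
  have hKo : IsOpen ((B' ⊓ c.bot : Subgroup G) : Set G) := by
    rw [Subgroup.coe_inf]
    exact (hG.1.isOpen hBn hBc hB'1).inter hSo
  have hB'B : B' ≤ B := hB'H.trans (inf_le_left.trans inf_le_right)
  have hB'N : ∀ N ∈ hfinN.toFinset, B' ≤ N := fun N hN =>
    hB'H.trans (inf_le_right.trans (inf_le_left.trans (iInf₂_le N hN)))
  have hB'E : ∀ U ∈ hfinU.toFinset, B' ≤ E U := fun U hU =>
    hB'H.trans (inf_le_right.trans (inf_le_right.trans (iInf₂_le U hU)))
  refine ⟨B', B' ⊓ c.bot, hBn, inferInstance, hKo, ?_, ?_, ?_, ?_, ?_, ?_⟩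
  · exact lt_of_le_of_ne inf_le_left fun h => hBS (inf_eq_left.1 h)
  · exact hB'H.trans (inf_le_left.trans inf_le_left)
  · intro N hN hKN
    by_cases h : N ≤ B
    · exact Or.inr h
    · refine Or.inl (hB'N N ?_)
      rw [Set.Finite.mem_toFinset]
      exact ⟨hN, N.isClosed_of_isOpen (Subgroup.isOpen_mono hKN hKo), h⟩
  · exact fun N hN hNc hlt => le_inf hlt.le (hmin N hN hNc hlt)
  · intro Q _ f hf
    refine c.mem_map 𝒞 hc hBR ?_ f hf
    by_contra hne
    refine c.chief (B' ⊔ c.bot) inferInstance ?_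
      ⟨lt_of_le_not_ge le_sup_right fun h => hBS (le_sup_left.trans h),
        lt_of_le_of_ne (sup_le hBR c.bot_lt_top.le) hne⟩
    exact Subgroup.isClosed_of_isOpen _ (Subgroup.isOpen_mono le_sup_right hSo)
  · intro Q _ f hfs hf U hU hBU
    refine hE U hU hBU f hfs (hf ▸ hKo) ?_ ?_
    · rw [hf]
      exact inf_le_left.trans (hB'E U (by rw [Set.Finite.mem_toFinset]; exact hBU))
    · rw [hf]
      exact inf_le_left.trans (hB'B.trans hBU)

theorem IsHereditarilyJustInfinite.exists_chain (hG : IsHereditarilyJustInfinite G)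
    (𝒞 : ℕ → FiniteGroupClass.{u})
    (h𝒞 : ∀ n, {c : ChiefFactor G | (𝒞 n).Mem c.Quotient}.Infinite) :
    ∃ B K : ℕ → Subgroup G, (∀ n, (B n).Normal) ∧ (∀ n, K n < B n) ∧ (∀ n, B (n + 2) ≤ K n) ∧
      ∀ n, ∃ H, IsDeepChiefFactor (𝒞 n) (B n) H (B (n + 1)) (K n) := by
  let X := {p : Subgroup G × Subgroup G // p.1.Normal ∧ IsOpen (p.1 : Set G) ∧
    IsOpen (p.2 : Set G)}
  have hstep : ∀ (n : ℕ) (p : X), ∃ q : X,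
      IsDeepChiefFactor (𝒞 n) p.1.1 (p.1.1 ⊓ p.1.2) q.1.1 q.1.2 := by
    rintro n ⟨⟨B, H⟩, hB, hBo, hHo⟩
    obtain ⟨B', K', h⟩ := hG.exists_isDeepChiefFactor (𝒞 n) (h𝒞 n) hB hBo
      (H := B ⊓ H) (by rw [Subgroup.coe_inf]; exact hBo.inter hHo)
    exact ⟨⟨(B', K'), h.normal_top, Subgroup.isOpen_mono h.lt.le h.isOpen_bot, h.isOpen_bot⟩, h⟩
  choose F hF using hstep
  -- A state is the pair `(B n, K (n - 1))`, with `⊤` standing for the absent `K (-1)`. Asking for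
  -- `B (n + 1) ≤ B n ⊓ K (n - 1)` produces the interlacing.
  let x : ℕ → X := fun n => Nat.rec ⟨(⊤, ⊤), inferInstance, isOpen_univ, isOpen_univ⟩ F n
  have hx : ∀ n, IsDeepChiefFactor (𝒞 n) (x n).1.1 ((x n).1.1 ⊓ (x n).1.2) (x (n + 1)).1.1
    (x (n + 1)).1.2 := fun n => hF n (x n)
  exact ⟨fun n => (x n).1.1, fun n => (x (n + 1)).1.2, fun n => (x n).2.1,
    fun n => (hx n).lt.trans_le ((hx n).le.trans inf_le_left),
    fun n => (hx (n + 1)).le.trans inf_le_right, fun n => ⟨_, hx n⟩⟩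

end Construction

/-! ### Inverse systems seen from a group mapping onto their terms. -/

namespace FiniteInverseSystem

/-- The inverse system of the quotients of a group by a descending sequence of normal subgroups of
finite index. -/
def ofNormal {G : Type u} [Group G] (K : ℕ → Subgroup G) (hn : ∀ n, (K n).Normal)
    (hf : ∀ n, (K n).FiniteIndex) (h : ∀ n, K (n + 1) ≤ K n) : FiniteInverseSystem.{u} where
  obj n := G ⧸ K n
  group := fun n => QuotientGroup.Quotient.group (K n)
  finite _ := Subgroup.finite_quotient_of_finiteIndex
  ρ n := QuotientGroup.map (K (n + 1)) (K n) (MonoidHom.id G) (h n)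
  surjective _ x := QuotientGroup.induction_on x fun g => ⟨g, rfl⟩

/-- A compatible family of surjective homomorphisms from a group `G` to the terms of an inverse
system. -/
structure Cone (Λ : FiniteInverseSystem.{u}) (G : Type u) [Group G] where
  π : ∀ n, G →* Λ.obj n
  surj : ∀ n, Function.Surjective (π n)
  comp : ∀ n g, Λ.ρ n (π (n + 1) g) = π n g

/-- The quotient maps onto the terms of `ofNormal`. -/
def coneOfNormal {G : Type u} [Group G] (K : ℕ → Subgroup G) (hn : ∀ n, (K n).Normal)
    (hf : ∀ n, (K n).FiniteIndex) (h : ∀ n, K (n + 1) ≤ K n) : (ofNormal K hn hf h).Cone G where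
  π n := QuotientGroup.mk' (K n)
  surj n := QuotientGroup.mk'_surjective (K n)
  comp _ _ := rfl

theorem ker_coneOfNormal {G : Type u} [Group G] (K : ℕ → Subgroup G) (hn : ∀ n, (K n).Normal)
    (hf : ∀ n, (K n).FiniteIndex) (h : ∀ n, K (n + 1) ≤ K n) (n : ℕ) :
    ((coneOfNormal K hn hf h).π n).ker = K n :=
  QuotientGroup.ker_mk' (K n)

namespace Cone

variable {Λ : FiniteInverseSystem.{u}} {G : Type u} [Group G] (c : Λ.Cone G)

theorem ker_le (n : ℕ) : (c.π (n + 1)).ker ≤ (c.π n).ker := by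
  intro g hg
  rw [MonoidHom.mem_ker] at hg ⊢
  rw [← c.comp, hg, map_one]

theorem ker_antitone : Antitone fun n => (c.π n).ker :=
  antitone_nat_of_succ_le c.ker_le

theorem map_ρ (n : ℕ) (B : Subgroup G) : (B.map (c.π (n + 1))).map (Λ.ρ n) = B.map (c.π n) := by
  rw [Subgroup.map_map]
  congr 1
  ext g
  exact c.comp n g

theorem map_ker (n : ℕ) : (c.π n).ker.map (c.π (n + 1)) = (Λ.ρ n).ker := by
  ext x
  obtain ⟨g, rfl⟩ := c.surj (n + 1) x
  constructor
  · rintro ⟨h, hh, hx⟩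
    rw [MonoidHom.mem_ker, ← hx, c.comp]
    exact hh
  · intro h
    refine ⟨g, ?_, rfl⟩
    rw [MonoidHom.mem_ker, c.comp] at h
    exact h

theorem comap_ker (n : ℕ) : (Λ.ρ n).ker.comap (c.π (n + 1)) = (c.π n).ker := by
  rw [← c.map_ker, Subgroup.comap_map_eq, sup_eq_left.2 (c.ker_le n)]

theorem map_comap (n : ℕ) (N : Subgroup (Λ.obj n)) : (N.comap (c.π n)).map (c.π n) = N :=
  Subgroup.map_comap_eq_self_of_surjective (c.surj n) N

theorem comap_map {n : ℕ} {N : Subgroup G} (h : (c.π n).ker ≤ N) :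
    (N.map (c.π n)).comap (c.π n) = N := by
  rw [Subgroup.comap_map_eq, sup_eq_left.2 h]

theorem ker_le_comap (n : ℕ) (N : Subgroup (Λ.obj n)) : (c.π n).ker ≤ N.comap (c.π n) :=
  Subgroup.comap_mono bot_le

theorem P_map (B : ℕ → Subgroup G) (n : ℕ) :
    Λ.P (fun n => (B n).map (c.π n)) n = (B (n + 1)).map (c.π n) :=
  c.map_ρ n _

variable [TopologicalSpace G] [IsTopologicalGroup G] [CompactSpace G]

theorem nonempty_equiv_limit (ho : ∀ n, IsOpen ((c.π n).ker : Set G))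
    (hbot : ⨅ n, (c.π n).ker = ⊥) : Nonempty (G ≃ₜ* Λ.Limit) := by
  let φ : G →* Λ.Limit := (MonoidHom.pi c.π).codRestrict Λ.limit fun g n => c.comp n g
  have hφ : ∀ g n, (φ g : ∀ n, Λ.obj n) n = c.π n g := fun _ _ => rfl
  have hinj : Function.Injective φ := by
    rw [injective_iff_map_eq_one]
    intro g hg
    rw [← Subgroup.mem_bot, ← hbot, Subgroup.mem_iInf]
    intro n
    rw [MonoidHom.mem_ker, ← hφ, hg]
    rfl
  have hcont : ∀ n, Continuous (c.π n) := fun n => by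
    refine continuous_of_continuousAt_one _ ?_
    rw [ContinuousAt, map_one, nhds_discrete (Λ.obj n)]
    refine Filter.tendsto_pure.2 ?_
    exact (ho n).mem_nhds (one_mem _)
  -- Surjectivity is compactness applied to nested nonempty fibres; a continuous bijection from a
  -- compact to a Hausdorff space is a homeomorphism.
  have hc : Continuous φ := by
    refine Continuous.subtype_mk (continuous_pi fun n => hcont n) _
  have hsurj : Function.Surjective φ := by
    intro x
    have hne : (⋂ n, c.π n ⁻¹' {(x : ∀ n, Λ.obj n) n}).Nonempty := by
      refine IsCompact.nonempty_iInter_of_sequence_nonempty_isCompact_isClosed _ (fun n => ?_)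
        (fun n => ?_) ?_ fun n => ?_
      · intro g hg
        rw [Set.mem_preimage, Set.mem_singleton_iff] at hg ⊢
        rw [← c.comp, hg]
        exact x.2 n
      · exact c.surj n _
      · exact ((isClosed_discrete _).preimage (hcont 0)).isCompact
      · exact (isClosed_discrete _).preimage (hcont n)
    obtain ⟨g, hg⟩ := hne
    rw [Set.mem_iInter] at hg
    exact ⟨g, Subtype.ext (funext fun n => hg n)⟩
  let e : G ≃* Λ.Limit := MulEquiv.ofBijective φ ⟨hinj, hsurj⟩
  exact ⟨{ e with
    continuous_toFun := hc
    continuous_invFun := Continuous.continuous_symm_of_equiv_compact_to_t2 (f := e.toEquiv) hc }⟩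

end Cone

end FiniteInverseSystem

theorem IsHereditarilyJustInfinite.exists_inverseSystem (G : Type u) [Group G]
    [TopologicalSpace G] [IsTopologicalGroup G] [CompactSpace G] [TotallyDisconnectedSpace G]
    (hG : IsHereditarilyJustInfinite G) (𝒞 : ℕ → FiniteGroupClass.{u})
    (h𝒞 : ∀ n, {c : ChiefFactor G | (𝒞 n).Mem c.Quotient}.Infinite) :
    ∃ (Λ : FiniteInverseSystem.{u}) (A : ∀ n, Subgroup (Λ.obj n)),
      Nonempty (G ≃ₜ* Λ.Limit) ∧
      ∀ n, (A n).Normal ∧ A n ≠ ⊥ ∧ Λ.CondI A n ∧ Λ.CondII A n ∧ Λ.CondIII A n ∧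
        Λ.CondIV A (𝒞 n) n ∧ Λ.CondV A n := by
  obtain ⟨B, K, hB, hKB, hBK, hdeep⟩ := hG.exists_chain 𝒞 h𝒞
  choose H hdeep using hdeep
  have hKn : ∀ n, (K n).Normal := fun n => (hdeep n).normal_bot
  have hKo : ∀ n, IsOpen (K n : Set G) := fun n => (hdeep n).isOpen_bot
  have hKf : ∀ n, (K n).FiniteIndex := fun n => finiteIndex_of_isOpen (hKo n)
  have hlt : ∀ n, K (n + 1) < K n := fun n => (hdeep (n + 1)).lt.trans_le (hBK n)
  have hbot : ⨅ n, K n = ⊥ := by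
    by_contra h
    have hn : (⨅ n, K n).Normal := Subgroup.normal_iInf_normal hKn
    have hc : IsClosed ((⨅ n, K n : Subgroup G) : Set G) := by
      rw [Subgroup.coe_iInf]
      exact isClosed_iInter fun n => (K n).isClosed_of_isOpen (hKo n)
    have := hG.1.2 _ hn hc h
    refine Set.infinite_range_of_injective (strictAnti_nat_of_succ_lt hlt).injective
      ((⨅ n, K n).finite_setOf_ge.subset ?_)
    rintro _ ⟨n, rfl⟩
    exact iInf_le K n
  have hex : ∃ (Λ : FiniteInverseSystem.{u}) (c : Λ.Cone G), ∀ n, (c.π n).ker = K n :=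
    ⟨_, FiniteInverseSystem.coneOfNormal K hKn hKf fun n => (hlt n).le,
      FiniteInverseSystem.ker_coneOfNormal _ _ _ _⟩
  obtain ⟨Λ, c, hker⟩ := hex
  refine ⟨Λ, fun n => (B n).map (c.π n),
    c.nonempty_equiv_limit (fun n => hker n ▸ hKo n) (by simpa only [hker] using hbot),
    fun n => ⟨(hB n).map _ (c.surj n), ?_, ⟨?_, ?_⟩, ?_, ?_, ?_, ?_⟩⟩
  · rw [Ne, Subgroup.map_eq_bot_iff, hker]
    exact (hKB n).not_ge
  · rw [c.P_map, ← c.map_ker, hker]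
    exact Subgroup.map_mono (hBK n)
  · rw [← c.map_ker, hker]
    -- A maximal invariant subgroup of `A (n + 1)` pulls back properly inside `B (n + 1)`, hence
    -- into `K n`; by maximality it contains the image of `K n`.
    refine le_inf (Subgroup.map_mono (hdeep n).lt.le) (le_sInf fun M hM => ?_)
    obtain ⟨⟨hMn, hMlt⟩, hmax⟩ := hM
    have hMc : IsClosed ((M.comap (c.π (n + 1)) : Subgroup G) : Set G) := by
      refine Subgroup.isClosed_of_isOpen _ (Subgroup.isOpen_mono (c.ker_le_comap (n + 1) M) ?_)
      rw [hker]
      exact hKo (n + 1)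
    have hMB : M.comap (c.π (n + 1)) < B (n + 1) := by
      rw [← c.comap_map (n := n + 1) (N := B (n + 1)) (hker (n + 1) ▸ (hKB (n + 1)).le)]
      exact (Subgroup.comap_lt_comap_of_surjective (c.surj (n + 1))).2 hMlt
    have hMK : M ≤ (K n).map (c.π (n + 1)) := by
      rw [← c.map_comap (n + 1) M]
      exact Subgroup.map_mono ((hdeep n).le_of_lt _ (hMn.comap _) hMc hMB)
    refine hmax ⟨(hKn n).map _ (c.surj (n + 1)), lt_of_le_not_ge (Subgroup.map_mono
      (hdeep n).lt.le) fun h => (hdeep n).lt.not_ge ?_⟩ hMK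
    rwa [Subgroup.map_le_iff_le_comap, c.comap_map] at h
    rw [hker]
    exact (hlt n).le
  · intro N hN
    rw [c.P_map]
    have hKN : K n ≤ N.comap (c.π n) := hker n ▸ c.ker_le_comap n N
    rw [Subgroup.map_le_iff_le_comap, ← c.map_comap n N]
    refine ((hdeep n).le_or_le _ (hN.comap _) hKN).imp (fun h => ?_) fun h => Subgroup.map_mono h
    rwa [c.map_comap]
  · rw [FiniteInverseSystem.CondIII, c.P_map]
    refine ⟨⟨(hdeep n).normal_top.map _ (c.surj n), ?_⟩, fun N hN hle => ?_⟩
    · rw [Ne, Subgroup.map_eq_bot_iff, hker]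
      exact (hdeep n).lt.not_ge
    · obtain ⟨hNn, hN1⟩ := hN
      have hKN : K n ≤ N.comap (c.π n) := hker n ▸ c.ker_le_comap n N
      have hNB : N.comap (c.π n) ≤ B (n + 1) := by
        rw [← c.comap_map (n := n) (N := B (n + 1)) (hker n ▸ (hdeep n).lt.le)]
        exact Subgroup.comap_mono hle
      rw [Subgroup.map_le_iff_le_comap]
      by_contra hcon
      have := (hdeep n).le_of_lt _ (hNn.comap _) (Subgroup.isClosed_of_isOpen _
        (Subgroup.isOpen_mono hKN (hKo n))) (lt_of_le_not_ge hNB hcon)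
      refine hN1 ?_
      rw [← c.map_comap n N, Subgroup.map_eq_bot_iff, hker]
      exact this
  · rw [FiniteInverseSystem.CondIV, c.P_map]
    exact (hdeep n).mem _ (hker n)
  · intro U hU hle
    rw [← c.map_comap n U]
    exact (hdeep n).indecomposable _ (c.surj n) (hker n) _ (hU.comap _)
      (Subgroup.map_le_iff_le_comap.1 hle)

/-! ### A criterion for just infinite groups to be hereditarily so. -/

section Criterion

variable {G : Type u} [Group G] [TopologicalSpace G] [IsTopologicalGroup G] [CompactSpace G]
  [TotallyDisconnectedSpace G]

theorem Subgroup.conj_smul_sInf (g : G) (S : Set (Subgroup G)) :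
    MulAut.conj g • sInf S = sInf ((fun X => MulAut.conj g • X) '' S) := by
  ext x
  simp only [Subgroup.mem_pointwise_smul_iff_inv_smul_mem, Subgroup.mem_sInf, Set.forall_mem_image]

theorem isClosed_conj_smul {N : Subgroup G} (hN : IsClosed (N : Set G)) (g : G) :
    IsClosed ((MulAut.conj g • N : Subgroup G) : Set G) := by
  have : ((MulAut.conj g • N : Subgroup G) : Set G) = (fun x => g⁻¹ * x * g) ⁻¹' N := by
    ext x
    rw [SetLike.mem_coe, Subgroup.mem_pointwise_smul_iff_inv_smul_mem, ← map_inv]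
    simp
  rw [this]
  exact hN.preimage (by fun_prop)

theorem Subgroup.Normal.le_normalizer_conj_smul {U N : Subgroup G} (hU : U.Normal)
    (h : U ≤ Subgroup.normalizer (N : Set G)) (g : G) :
    U ≤ Subgroup.normalizer ((MulAut.conj g • N : Subgroup G) : Set G) := by
  rw [Subgroup.le_normalizer_iff] at h ⊢
  intro u hu x hx
  rw [Subgroup.mem_pointwise_smul_iff_inv_smul_mem, ← map_inv, MulAut.smul_def,
    MulAut.conj_apply] at hx ⊢
  have := h (g⁻¹ * u * g) (by simpa using hU.conj_mem u hu g⁻¹) _ hx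
  simpa [mul_assoc] using this

/-- If a closed subgroup `N` has finitely many conjugates, then it contains, up to conjugacy, a
nontrivial intersection of conjugates whose distinct conjugates intersect trivially. -/
theorem exists_basal_of_finite_conj {N : Subgroup G} (hc : IsClosed (N : Set G)) (h1 : N ≠ ⊥)
    {U : Subgroup G} (hU : U.Normal) (hUf : U.FiniteIndex) (hNU : N ≤ U)
    (hn : U ≤ Subgroup.normalizer (N : Set G)) :
    ∃ V : Subgroup G, IsClosed (V : Set G) ∧ V ≠ ⊥ ∧ V ≤ U ∧
      U ≤ Subgroup.normalizer (V : Set G) ∧ (∃ g : G, V ≤ MulAut.conj g • N) ∧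
      ∀ g : G, MulAut.conj g • V ≠ V → MulAut.conj g • V ⊓ V = ⊥ := by
  set O : Set (Subgroup G) := Set.range fun g : G => MulAut.conj g • N with hO
  have hOfin : O.Finite := by
    have : Finite (G ⧸ U) := Subgroup.finite_quotient_of_finiteIndex
    refine (Set.finite_range fun q : G ⧸ U => MulAut.conj q.out • N).subset ?_
    rintro _ ⟨g, rfl⟩
    obtain ⟨⟨u, hu⟩, hu'⟩ := QuotientGroup.mk_out_eq_mul U g
    refine ⟨(g : G ⧸ U), ?_⟩
    simp only [hu', map_mul, mul_smul]
    congr 1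
    ext x
    rw [Subgroup.mem_pointwise_smul_iff_inv_smul_mem, ← map_inv, MulAut.smul_def,
      MulAut.conj_apply]
    exact (Subgroup.mem_normalizer_iff.1 (inv_mem (hn hu)) x).symm
  have hOconj : ∀ g : G, ∀ X ∈ O, MulAut.conj g • X ∈ O := by
    rintro g _ ⟨h, rfl⟩
    exact ⟨g * h, by simp [map_mul, mul_smul]⟩
  -- Take a largest set `S` of conjugates with nontrivial intersection. If a conjugate of `sInf S`
  -- meets it nontrivially, then `gS ∪ S` is no larger than `S`, so `gS = S`.
  have hfin : {S : Set (Subgroup G) | S ⊆ O ∧ S.Nonempty ∧ sInf S ≠ ⊥}.Finite :=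
    hOfin.finite_subsets.subset fun S hS => hS.1
  obtain ⟨S, ⟨hSO, hSne, hS1⟩, hmax⟩ := Set.exists_max_image _ Set.ncard hfin
    ⟨{N}, by rintro _ rfl; exact ⟨1, by simp⟩, Set.singleton_nonempty N, by simpa using h1⟩
  have hSfin : S.Finite := hOfin.subset hSO
  have hmem : ∀ X ∈ S, IsClosed (X : Set G) ∧ X ≤ U ∧ U ≤ Subgroup.normalizer (X : Set G) := by
    intro X hX
    obtain ⟨g, rfl⟩ := hSO hX
    exact ⟨isClosed_conj_smul hc g, hU.conj_smul_le hNU g, hU.le_normalizer_conj_smul hn g⟩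
  obtain ⟨X₀, hX₀⟩ := hSne
  refine ⟨sInf S, ?_, hS1, (sInf_le hX₀).trans (hmem X₀ hX₀).2.1, ?_, ?_, ?_⟩
  · rw [Subgroup.coe_sInf]
    exact isClosed_biInter fun X hX => (hmem X hX).1
  · rw [Subgroup.le_normalizer_iff]
    intro u hu x hx
    rw [Subgroup.mem_sInf] at hx ⊢
    exact fun X hX => Subgroup.le_normalizer_iff.1 (hmem X hX).2.2 u hu x (hx X hX)
  · obtain ⟨g, rfl⟩ := hSO hX₀
    exact ⟨g, sInf_le hX₀⟩
  · intro g hg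
    by_contra hne
    refine hg ?_
    rw [Subgroup.conj_smul_sInf] at hne ⊢
    set T := (fun X => MulAut.conj g • X) '' S with hT
    have hTfin : T.Finite := hSfin.image _
    have hTcard : T.ncard = S.ncard :=
      Set.ncard_image_of_injective S (MulAction.injective (MulAut.conj g))
    rw [← sInf_union] at hne
    have hTO : T ⊆ O := by
      rintro _ ⟨X, hX, rfl⟩
      exact hOconj g X (hSO hX)
    have hle := hmax (T ∪ S) ⟨Set.union_subset hTO hSO, ⟨X₀, Or.inr hX₀⟩, hne⟩
    have h2 : S = T ∪ S := Set.eq_of_subset_of_ncard_le Set.subset_union_right hle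
      (hTfin.union hSfin)
    have h3 : T ⊆ S := h2 ▸ Set.subset_union_left
    rw [Set.eq_of_subset_of_ncard_le h3 hTcard.ge hSfin]

/-- A just infinite profinite group is hereditarily just infinite if no open normal subgroup is
topologically generated by a conjugacy class of proper closed subgroups that commute pairwise. -/
theorem IsJustInfinite.isHereditarilyJustInfinite (hG : IsJustInfinite G)
    (hbasal : ∀ W V : Subgroup G, W.Normal → IsOpen (W : Set G) → IsClosed (V : Set G) → V < W →
      (⨆ g : G, MulAut.conj g • V).topologicalClosure = W →
      (∀ g h : G, MulAut.conj g • V ≠ MulAut.conj h • V →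
        ⁅MulAut.conj g • V, MulAut.conj h • V⁆ = ⊥) → False) :
    IsHereditarilyJustInfinite G := by
  have := hG.1
  have claim : ∀ U N : Subgroup G, U.Normal → IsOpen (U : Set G) → IsClosed (N : Set G) → N ≠ ⊥ →
      N ≤ U → U ≤ Subgroup.normalizer (N : Set G) → N.FiniteIndex := by
    intro U N hU hUo hNc hN1 hNU hUN
    obtain ⟨V, hVc, hV1, hVU, hUV, ⟨g, hVN⟩, hV⟩ :=
      exists_basal_of_finite_conj hNc hN1 hU (finiteIndex_of_isOpen hUo) hNU hUN
    by_cases hVn : V.Normal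
    · have := hG.2 V hVn hVc hV1
      refine Subgroup.finiteIndex_of_le (H := V) ?_
      rwa [Subgroup.subset_pointwise_smul_iff, ← map_inv, hVn.conj_smul_eq_self] at hVN
    · exfalso
      set W := (⨆ g : G, MulAut.conj g • V).topologicalClosure with hW
      have := V.normal_iSup_conj
      have hWn : W.Normal := Subgroup.is_normal_topologicalClosure _
      have hVW : V ≤ W := V.le_iSup_conj.trans (Subgroup.le_topologicalClosure _)
      have hWc : IsClosed (W : Set G) := Subgroup.isClosed_topologicalClosure _
      have hWo : IsOpen (W : Set G) := hG.isOpen hWn hWc fun h => hV1 (le_bot_iff.1 (h ▸ hVW))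
      refine hbasal W V hWn hWo hVc (lt_of_le_of_ne hVW fun h => hVn (h ▸ hWn)) rfl ?_
      -- Distinct conjugates of `V` are normalized by `U`, lie in `U` and meet trivially, so they
      -- commute.
      intro a b hab
      have h1 : MulAut.conj (b⁻¹ * a) • V ≠ V := by
        intro h
        refine hab ?_
        nth_rewrite 2 [← h]
        rw [smul_smul, ← map_mul, mul_inv_cancel_left]
      have h2 : MulAut.conj a • V ⊓ MulAut.conj b • V = ⊥ := by
        have := congrArg (fun X => MulAut.conj b • X) (hV _ h1)
        simpa [Subgroup.smul_inf, smul_smul, ← map_mul] using this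
      have hle : ⁅MulAut.conj a • V, MulAut.conj b • V⁆ ≤
          MulAut.conj a • V ⊓ MulAut.conj b • V := by
        refine le_inf ?_ ?_
        · exact Subgroup.le_normalizer_iff_commutator_le_left.1
            ((hU.conj_smul_le hVU b).trans (hU.le_normalizer_conj_smul hUV a))
        · exact Subgroup.le_normalizer_iff_commutator_le_right.1
            ((hU.conj_smul_le hVU a).trans (hU.le_normalizer_conj_smul hUV b))
      exact le_bot_iff.1 (h2 ▸ hle)
  refine ⟨hG, fun H hH => ⟨?_, fun N hN hNc hN1 => ?_⟩⟩
  · have := finiteIndex_of_isOpen hH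
    by_contra hfin
    rw [not_infinite_iff_finite] at hfin
    have := (Subgroup.finite_iff_finite_and_finiteIndex (H := H)).2 ⟨hfin, this⟩
    exact not_finite G
  · obtain ⟨U, hU, hUo, hUH⟩ := exists_isOpen_normal_le hH
    set N' := N.map H.subtype with hN'
    have hN'c : IsClosed (N' : Set G) := by
      rw [hN', Subgroup.coe_map]
      exact ((H.isClosed_of_isOpen hH).isClosedEmbedding_subtypeVal).isClosedMap _ hNc
    have hN'1 : N' ≠ ⊥ := by
      rwa [hN', Ne, Subgroup.map_eq_bot_iff_of_injective _ H.subtype_injective]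
    have hHN : H ≤ Subgroup.normalizer (N' : Set G) := by
      rw [Subgroup.le_normalizer_iff]
      rintro h hh _ ⟨n, hn, rfl⟩
      exact ⟨_, hN.conj_mem n hn ⟨h, hh⟩, rfl⟩
    suffices hfi : N'.FiniteIndex by
      have : N = N'.subgroupOf H := (Subgroup.comap_map_eq_self_of_injective
        H.subtype_injective N).symm
      rw [this]
      infer_instance
    -- If the intersection is trivial, `N'` centralizes `U`. Then `C` is open with centre of finite
    -- index, hence abelian, so it normalizes `N'` and can replace `U` in the claim.
    by_cases hcap : N' ⊓ U = ⊥
    · have hNC : N' ≤ Subgroup.centralizer (U : Set G) := by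
        rw [← Subgroup.commutator_eq_bot_iff_le_centralizer, ← le_bot_iff, ← hcap]
        refine le_inf ?_ ?_
        · exact Subgroup.le_normalizer_iff_commutator_le_left.1 (hUH.trans hHN)
        · exact Subgroup.commutator_le_right _ _
      set C := Subgroup.centralizer (U : Set G) with hC
      have hCn : C.Normal := inferInstance
      have hCc : IsClosed (C : Set G) := by
        rw [hC]
        exact Set.isClosed_centralizer _
      have hCo := hG.isOpen hCn hCc fun h => hN'1 (le_bot_iff.1 (h ▸ hNC))
      have hcen : (Subgroup.center C).FiniteIndex := by
        have := finiteIndex_subgroupOf_of_isOpen (U := C) hUo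
        refine Subgroup.finiteIndex_of_le (H := U.subgroupOf C) fun d hd => ?_
        rw [Subgroup.mem_center_iff]
        intro x
        exact Subtype.ext
          (Subgroup.mem_centralizer_iff.1 x.2 d (Subgroup.mem_subgroupOf.1 hd)).symm
      have hab := hG.commute_of_finiteIndex_center hCn
      refine claim C N' hCn hCo hN'c hN'1 hNC ?_
      rw [Subgroup.le_normalizer_iff]
      intro x hx y hy
      rw [hab x hx y (hNC hy), mul_inv_cancel_right]
      exact hy
    · have := claim U (N' ⊓ U) hU hUo ?_ hcap inf_le_right ?_
      · exact Subgroup.finiteIndex_of_le (H := N' ⊓ U) inf_le_left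
      · rw [Subgroup.coe_inf]
        exact hN'c.inter (U.isClosed_of_isOpen hUo)
      · rw [Subgroup.le_normalizer_iff]
        intro u hu x hx
        exact ⟨Subgroup.le_normalizer_iff.1 (hUH.trans hHN) u hu x hx.1, hU.conj_mem x hx.2 u⟩

end Criterion

/-! ### The converse: recovering the properties of the limit from (i), (ii) and (v). -/

theorem invariantCosocle_lt {Q : Type u} [Group Q] [Finite Q] {A : Subgroup Q} (hA : A ≠ ⊥) :
    invariantCosocle A < A := by
  have hfin : {C : Subgroup Q | C.Normal ∧ C < A}.Finite := Set.toFinite _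
  obtain ⟨M, -, hM⟩ := hfin.exists_le_maximal (a := ⊥) ⟨inferInstance, bot_lt_iff_ne_bot.2 hA⟩
  exact lt_of_le_of_lt (inf_le_right.trans (sInf_le hM) : invariantCosocle A ≤ M) hM.prop.2

/-- The cosocle behaves like a Frattini subgroup: a proper invariant `X` lies in a maximal one,
which also contains the cosocle. -/
theorem le_of_le_sup_invariantCosocle {Q : Type u} [Group Q] [Finite Q] {A X : Subgroup Q}
    (hX : X.Normal) (hXA : X ≤ A) (h : A ≤ X ⊔ invariantCosocle A) : A ≤ X := by
  by_contra hcon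
  have hfin : {C : Subgroup Q | C.Normal ∧ C < A}.Finite := Set.toFinite _
  obtain ⟨M, hXM, hM⟩ := hfin.exists_le_maximal (a := X) ⟨hX, lt_of_le_not_ge hXA hcon⟩
  exact hM.prop.2.not_ge (h.trans (sup_le hXM (inf_le_right.trans (sInf_le hM))))

namespace FiniteInverseSystem

namespace Cone

variable {Λ : FiniteInverseSystem.{u}} {G : Type u} [Group G] (c : Λ.Cone G)
  {A : ∀ n, Subgroup (Λ.obj n)}

theorem ker_lt_comap {n : ℕ} (hA : A (n + 1) ≠ ⊥) (hI : Λ.CondI A n) :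
    (c.π n).ker < (A (n + 1)).comap (c.π (n + 1)) := by
  rw [← c.comap_ker, Subgroup.comap_lt_comap_of_surjective (c.surj (n + 1))]
  exact hI.2.trans_lt (invariantCosocle_lt hA)

theorem comap_le_ker {n : ℕ} (hI : Λ.CondI A n) :
    (A (n + 2)).comap (c.π (n + 2)) ≤ (c.π n).ker := by
  intro g hg
  have h1 : c.π (n + 1) g ∈ Λ.P A (n + 1) := ⟨_, hg, c.comp (n + 1) g⟩
  have h2 := hI.1 h1
  rwa [MonoidHom.mem_ker, c.comp] at h2

theorem comap_le_or_le {n : ℕ} (hII : Λ.CondII A n) {N : Subgroup G} (hN : N.Normal)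
    (hle : (c.π n).ker ≤ N) :
    (A (n + 1)).comap (c.π (n + 1)) ≤ N ∨ N ≤ (A n).comap (c.π n) := by
  refine (hII (N.map (c.π n)) (hN.map _ (c.surj n))).imp (fun h g hg => ?_)
    Subgroup.map_le_iff_le_comap.1
  have h1 : c.π n g ∈ Λ.P A n := ⟨_, hg, c.comp n g⟩
  rw [← c.comap_map hle]
  exact h h1

/-- As `B` contains the kernel of `c.π n`, the modular law gives `B = (N ⊓ B) ker`. By (i) the
kernel maps into the cosocle, so it can be dropped. -/
theorem comap_le_of_le_sup {n : ℕ} (hAn : (A (n + 1)).Normal) (hI : Λ.CondI A n) {N : Subgroup G}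
    (hN : N.Normal) (hle : (c.π (n + 1)).ker ≤ N)
    (h : (A (n + 1)).comap (c.π (n + 1)) ≤ N ⊔ (c.π n).ker) :
    (A (n + 1)).comap (c.π (n + 1)) ≤ N := by
  set B := (A (n + 1)).comap (c.π (n + 1)) with hB
  have hKA : (Λ.ρ n).ker ≤ A (n + 1) := hI.2.trans inf_le_left
  have hKB : (c.π n).ker ≤ B := by
    rw [← c.comap_ker]
    exact Subgroup.comap_mono hKA
  have hBn : B.Normal := hAn.comap _
  have key : A (n + 1) ≤ (N ⊓ B).map (c.π (n + 1)) := by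
    refine le_of_le_sup_invariantCosocle (Subgroup.Normal.map inferInstance _ (c.surj (n + 1)))
      (Subgroup.map_le_iff_le_comap.2 inf_le_right) ?_
    refine le_trans ?_ (sup_le_sup_left hI.2 _)
    rw [← c.map_ker, ← Subgroup.map_sup, ← c.map_comap (n + 1) (A (n + 1))]
    refine Subgroup.map_mono fun g hg => ?_
    have hg' := h hg
    rw [← SetLike.mem_coe, Subgroup.mul_normal] at hg' ⊢
    obtain ⟨x, hx, k, hk, rfl⟩ := hg'
    exact ⟨x, ⟨hx, (B.mul_mem_cancel_right (hKB hk)).1 hg⟩, k, hk, rfl⟩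
  calc B ≤ ((N ⊓ B).map (c.π (n + 1))).comap (c.π (n + 1)) := Subgroup.comap_mono key
    _ ≤ (N.map (c.π (n + 1))).comap (c.π (n + 1)) :=
      Subgroup.comap_mono (Subgroup.map_mono inf_le_left)
    _ = N := c.comap_map hle

variable [TopologicalSpace G] [IsTopologicalGroup G] [CompactSpace G] [TotallyDisconnectedSpace G]

/-- A closed `N` is the intersection of the subgroups `N K_n`, by compactness. -/
theorem exists_notMem_sup (ho : ∀ n, IsOpen ((c.π n).ker : Set G))
    (hbot : ⨅ n, (c.π n).ker = ⊥) {N : Subgroup G} (hN : IsClosed (N : Set G)) {x : G}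
    (hx : x ∉ N) : ∃ n, x ∉ N ⊔ (c.π n).ker := by
  by_contra! h
  have hne : (⋂ n, (N : Set G) ∩ (fun y => x⁻¹ * y) ⁻¹' (c.π n).ker).Nonempty := by
    have hcl : ∀ n, IsClosed ((N : Set G) ∩ (fun y => x⁻¹ * y) ⁻¹' (c.π n).ker) := fun n =>
      hN.inter ((Subgroup.isClosed_of_isOpen _ (ho n)).preimage (by fun_prop))
    refine IsCompact.nonempty_iInter_of_sequence_nonempty_isCompact_isClosed _ (fun n => ?_)
      (fun n => ?_) (hcl 0).isCompact hcl
    · exact Set.inter_subset_inter_right _ (Set.preimage_mono (c.ker_le n))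
    · have := h n
      rw [← SetLike.mem_coe, Subgroup.mul_normal] at this
      obtain ⟨y, hy, k, hk, rfl⟩ := this
      refine ⟨y, hy, ?_⟩
      rw [Set.mem_preimage]
      simpa using hk
  obtain ⟨y, hy⟩ := hne
  rw [Set.mem_iInter] at hy
  have hxy : x⁻¹ * y ∈ ⨅ n, (c.π n).ker := by
    rw [Subgroup.mem_iInf]
    exact fun n => (hy n).2
  rw [hbot, Subgroup.mem_bot, inv_mul_eq_one] at hxy
  exact hx (hxy ▸ (hy 0).1)

theorem exists_ker_le (ho : ∀ n, IsOpen ((c.π n).ker : Set G))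
    (hbot : ⨅ n, (c.π n).ker = ⊥) {W : Subgroup G} (hW : IsOpen (W : Set G)) :
    ∃ n, (c.π n).ker ≤ W := by
  by_contra! h
  have hne : (⋂ n, ((c.π n).ker : Set G) ∩ (W : Set G)ᶜ).Nonempty := by
    have hcl : ∀ n, IsClosed (((c.π n).ker : Set G) ∩ (W : Set G)ᶜ) := fun n =>
      (Subgroup.isClosed_of_isOpen _ (ho n)).inter hW.isClosed_compl
    refine IsCompact.nonempty_iInter_of_sequence_nonempty_isCompact_isClosed _ (fun n => ?_)
      (fun n => ?_) (hcl 0).isCompact hcl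
    · exact Set.inter_subset_inter_left _ (c.ker_le n)
    · obtain ⟨x, hx, hx'⟩ := SetLike.not_le_iff_exists.1 (h n)
      exact ⟨x, hx, hx'⟩
  obtain ⟨y, hy⟩ := hne
  rw [Set.mem_iInter] at hy
  have hy1 : y ∈ ⨅ n, (c.π n).ker := by
    rw [Subgroup.mem_iInf]
    exact fun n => (hy n).1
  rw [hbot, Subgroup.mem_bot] at hy1
  exact (hy 0).2 (hy1 ▸ W.one_mem)

theorem isJustInfinite (ho : ∀ n, IsOpen ((c.π n).ker : Set G))
    (hbot : ⨅ n, (c.π n).ker = ⊥) (hA : ∀ n, (A n).Normal ∧ A n ≠ ⊥) {n₀ : ℕ}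
    (hI : ∀ n ≥ n₀, Λ.CondI A n) (hII : ∀ n ≥ n₀, Λ.CondII A n) : IsJustInfinite G := by
  refine ⟨?_, fun N hN hNc hN1 => ?_⟩
  · have hlt : ∀ n, (c.π (n₀ + (n + 1))).ker < (c.π (n₀ + n)).ker := fun n =>
      (c.ker_lt_comap (hA _).2 (hI (n₀ + n + 1) (by omega))).trans_le
        (c.comap_le_ker (hI (n₀ + n) (by omega)))
    by_contra hfin
    rw [not_infinite_iff_finite] at hfin
    exact Set.infinite_range_of_injective
      (strictAnti_nat_of_succ_lt (f := fun n => (c.π (n₀ + n)).ker) hlt).injective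
      (Set.toFinite _)
  · obtain ⟨x, hx, hx1⟩ := N.bot_or_exists_ne_one.resolve_left hN1
    obtain ⟨n₁, hn₁⟩ := c.exists_notMem_sup ho hbot (N := ⊥)
      (by simp) (x := x) (by simpa using hx1)
    rw [bot_sup_eq] at hn₁
    obtain ⟨n, hn₀, hn⟩ : ∃ n ≥ n₀, ¬ N ≤ (c.π n).ker :=
      ⟨max n₀ n₁, le_max_left _ _, fun h => hn₁ (c.ker_antitone (le_max_right _ _) (h hx))⟩
    -- The second alternative of (ii) would give `N ≤ B_j ≤ K_(j-2) ≤ K_n`.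
    have h1 : ∀ j ≥ n + 2, (A (j + 1)).comap (c.π (j + 1)) ≤ N ⊔ (c.π j).ker := by
      intro j hj
      refine (c.comap_le_or_le (hII j (by omega)) inferInstance le_sup_right).resolve_right
        fun h => hn ?_
      obtain ⟨i, rfl⟩ := Nat.exists_eq_add_of_le' (show 2 ≤ j by omega)
      exact le_sup_left.trans (h.trans ((c.comap_le_ker (hI i (by omega))).trans
        (c.ker_antitone (by omega))))
    -- `K_j < B_(j+1) ≤ N K_j`, and the cosocle argument improves the bound to `B_(j+1) ≤ N
    -- K_(j+1)`.
    have h2 : ∀ j ≥ n + 2, N ⊔ (c.π j).ker ≤ N ⊔ (c.π (j + 1)).ker := by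
      intro j hj
      have hIj := hI j (by omega)
      refine sup_le le_sup_left ((c.ker_lt_comap (hA _).2 hIj).le.trans ?_)
      refine c.comap_le_of_le_sup (hA _).1 hIj inferInstance le_sup_right ((h1 j hj).trans ?_)
      exact sup_le_sup_right le_sup_left _
    have h3 : ∀ j ≥ n + 2, N ⊔ (c.π (n + 2)).ker ≤ N ⊔ (c.π j).ker := by
      intro j hj
      induction j, hj using Nat.le_induction with
      | base => exact le_rfl
      | succ j hj ih => exact ih.trans (h2 j hj)
    have h4 : (c.π (n + 2)).ker ≤ N := by
      intro x hx
      by_contra hxN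
      obtain ⟨j, hj⟩ := c.exists_notMem_sup ho hbot hNc hxN
      refine hj ?_
      have h5 := h3 (max j (n + 2)) (le_max_right _ _) (le_sup_right (a := N) hx)
      exact sup_le_sup_left (c.ker_antitone (le_max_left _ _)) N h5
    have := finiteIndex_of_isOpen (ho (n + 2))
    exact Subgroup.finiteIndex_of_le h4

theorem isHereditarilyJustInfinite (ho : ∀ n, IsOpen ((c.π n).ker : Set G))
    (hbot : ⨅ n, (c.π n).ker = ⊥) (hA : ∀ n, (A n).Normal ∧ A n ≠ ⊥) {n₀ : ℕ}
    (hI : ∀ n ≥ n₀, Λ.CondI A n) (hII : ∀ n ≥ n₀, Λ.CondII A n)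
    (hV : {n | Λ.CondV A n}.Infinite) : IsHereditarilyJustInfinite G := by
  refine (c.isJustInfinite ho hbot hA hI hII).isHereditarilyJustInfinite
    fun W V hWn hWo hVc hVW hVgen hcomm => ?_
  obtain ⟨x, hxW, hxV⟩ := SetLike.exists_of_lt hVW
  obtain ⟨n₁, hn₁⟩ := c.exists_notMem_sup ho hbot hVc hxV
  obtain ⟨n₂, hn₂⟩ := c.exists_ker_le ho hbot hWo
  -- Beyond `n₁` the image of `V` stays proper in that of `W`; beyond `n₂ + 2` the image of `W`
  -- contains `A n`, because `B_n ≤ K_(n-2) ≤ W`.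
  obtain ⟨n, hn, hlt⟩ := hV.exists_gt (n₀ + n₁ + n₂ + 2)
  obtain ⟨i, rfl⟩ := Nat.exists_eq_add_of_le' (show 2 ≤ n by omega)
  have hAW : A (i + 2) ≤ W.map (c.π (i + 2)) := by
    rw [← c.map_comap (i + 2) (A (i + 2))]
    exact Subgroup.map_mono ((c.comap_le_ker (hI i (by omega))).trans
      ((c.ker_antitone (by omega)).trans hn₂))
  set f := c.π (i + 2) with hf
  have hfs : Function.Surjective f := c.surj (i + 2)
  have hWfn : (W.map f).Normal := hWn.map _ hfs
  have hWle : W ≤ (⨆ g : G, MulAut.conj g • V) ⊔ f.ker := by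
    rw [← hVgen]
    exact Subgroup.topologicalClosure_minimal _ le_sup_left
      (Subgroup.isClosed_of_isOpen _ (Subgroup.isOpen_mono le_sup_right (ho _)))
  have hVle : ∀ g : G, MulAut.conj g • V ≤ W := fun g => hWn.conj_smul_le hVW.le g
  have hVf : V.map f < W.map f := by
    refine lt_of_le_not_ge (Subgroup.map_mono hVW.le) fun h => hn₁ ?_
    rw [Subgroup.map_le_iff_le_comap, Subgroup.comap_map_eq] at h
    exact sup_le_sup_left (c.ker_antitone (by omega)) V (h hxW)
  refine hn (W.map f) hWfn hAW ⟨Set.range fun q => MulAut.conj q • V.map f,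
    ⟨hWfn, ⟨?_, ?_⟩, V.map f, rfl⟩, ?_⟩
  · rw [sSup_range, ← hfs.iSup_comp (g := fun q => MulAut.conj q • V.map f)]
    simp only [← Subgroup.map_conj_smul]
    rw [← Subgroup.map_iSup]
    refine le_antisymm (Subgroup.map_mono (iSup_le hVle)) ?_
    rw [Subgroup.map_le_iff_le_comap, Subgroup.comap_map_eq]
    exact hWle
  · rintro _ ⟨q, rfl⟩ _ ⟨r, rfl⟩ hqr
    obtain ⟨g, rfl⟩ := hfs q
    obtain ⟨h, rfl⟩ := hfs r
    simp only [← Subgroup.map_conj_smul] at hqr ⊢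
    rw [← Subgroup.map_commutator, hcomm g h fun heq => hqr (by rw [heq]), Subgroup.map_bot]
  · rintro _ ⟨q, rfl⟩
    refine lt_of_le_not_ge (hWfn.conj_smul_le hVf.le q) fun h => hVf.not_ge ?_
    simp only at h
    rwa [Subgroup.subset_pointwise_smul_iff, ← map_inv, hWfn.conj_smul_eq_self] at h

end Cone

/-! ### Projections from the limit. -/

variable (Λ : FiniteInverseSystem.{u})

/-- The inverse system without its first term. -/
def shift : FiniteInverseSystem.{u} where
  obj n := Λ.obj (n + 1)
  group n := Λ.group (n + 1)
  finite n := Λ.finite (n + 1)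
  ρ n := Λ.ρ (n + 1)
  surjective n := Λ.surjective (n + 1)

theorem exists_limit_apply_eq (n : ℕ) (x : Λ.obj n) :
    ∃ y : Λ.Limit, (y : ∀ n, Λ.obj n) n = x := by
  induction n generalizing Λ with
  | zero =>
    -- Sections extend a first term upwards; a later term is lifted in the shifted system and the
    -- missing first entry is its image under `ρ 0`.
    choose s hs using Λ.surjective
    exact ⟨⟨fun k => Nat.rec x s k, fun k => hs k _⟩, rfl⟩
  | succ n ih =>
    obtain ⟨y, hy⟩ := ih Λ.shift x
    let z : ∀ k, Λ.obj k
      | 0 => Λ.ρ 0 (y.1 0)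
      | k + 1 => y.1 k
    refine ⟨⟨z, fun k => ?_⟩, hy⟩
    cases k with
    | zero => rfl
    | succ k => exact y.2 k

/-- The projections from the limit. -/
def limitCone : Λ.Cone Λ.Limit where
  π n := (Pi.evalMonoidHom Λ.obj n).comp Λ.limit.subtype
  surj n := Λ.exists_limit_apply_eq n
  comp n x := x.2 n

theorem isOpen_ker_limitCone (n : ℕ) : IsOpen ((Λ.limitCone.π n).ker : Set Λ.Limit) := by
  have hc : Continuous (Λ.limitCone.π n) := (continuous_apply n).comp continuous_subtype_val
  exact (isOpen_discrete ({1} : Set (Λ.obj n))).preimage hc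

theorem iInf_ker_limitCone : ⨅ n, (Λ.limitCone.π n).ker = ⊥ := by
  rw [eq_bot_iff]
  intro x hx
  rw [Subgroup.mem_iInf] at hx
  exact Subtype.ext (funext fun n => hx n)

end FiniteInverseSystem

theorem theorem5p1 :
    (∀ (G : Type u) [Group G] [TopologicalSpace G] [IsTopologicalGroup G] [CompactSpace G]
      [TotallyDisconnectedSpace G], IsHereditarilyJustInfinite G →
      ∀ 𝒞 : ℕ → FiniteGroupClass.{u},
        (∀ n, {c : ChiefFactor G | (𝒞 n).Mem c.Quotient}.Infinite) →
        ∃ (Λ : FiniteInverseSystem.{u}) (A : ∀ n, Subgroup (Λ.obj n)),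
          Nonempty (G ≃ₜ* Λ.Limit) ∧
          ∀ n, (A n).Normal ∧ A n ≠ ⊥ ∧ Λ.CondI A n ∧ Λ.CondII A n ∧ Λ.CondIII A n ∧
            Λ.CondIV A (𝒞 n) n ∧ Λ.CondV A n) ∧
    (∀ (Λ : FiniteInverseSystem.{u}) (A : ∀ n, Subgroup (Λ.obj n)),
      (∀ n, (A n).Normal ∧ A n ≠ ⊥) →
      {n | ¬ (Λ.CondI A n ∧ Λ.CondII A n)}.Finite →
      {n | Λ.CondV A n}.Infinite →
      IsHereditarilyJustInfinite Λ.Limit) := by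
  refine ⟨fun G _ _ _ _ _ hG 𝒞 h𝒞 => hG.exists_inverseSystem G 𝒞 h𝒞, fun Λ A hA hfin hV => ?_⟩
  obtain ⟨m, hm⟩ := hfin.bddAbove
  have h : ∀ n ≥ m + 1, Λ.CondI A n ∧ Λ.CondII A n := by
    intro n hn
    by_contra hcon
    have : n ≤ m := hm hcon
    omega
  exact Λ.limitCone.isHereditarilyJustInfinite Λ.isOpen_ker_limitCone Λ.iInf_ker_limitCone hA
    (fun n hn => (h n hn).1) (fun n hn => (h n hn).2) hV
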